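/- Let $M$ be a (finite-dimensional) smooth manifold and let $\omega$ be a 2-plectic form on $M$: a smooth closed 3-form such that, for all $x\in M$ and $v\in T_xM$, $\iota_v\omega=0$ implies $v=0$. A smooth 1-form $\alpha$ is Hamiltonian if $d\alpha=-\iota_{v_\alpha}\omega$ for a (necessarily unique) smooth vector field $v_\alpha$; let $\mathrm{Ham}(M)$ be the space of Hamiltonian 1-forms, and let $L=(L_1\xrightarrow{d}L_0)$ be the complex $C^\infty(M)\xrightarrow{d}\mathrm{Ham}(M)$. A weak Lie 2-algebra (Roytenberg) is a 2-term complex of vector spaces $L=(L_1\xrightarrow{d}L_0)$ with a chain map $[\cdot,\cdot]\colon L\otimes L\to L$, a chain homotopy $S$ (alternator) from $x\otimes y\mapsto[x,y]$ to $x\otimes y\mapsto-[y,x]$, and a chain homotopy $J$ (Jacobiator) from $x\otimes y\otimes z\mapsto[x,[y,z]]$ to $x\otimes y\otimes z\mapsto[[x,y],z]+[y,[x,z]]$, such that for all $x,y,z,w\in L_0$ $$[x,J(y,z,w)]+J(x,[y,z],w)+J(x,z,[y,w])+[J(x,y,z),w]+[z,J(x,y,w)]$$ $$=J(x,y,[z,w])+J([x,y],z,w)+[y,J(x,z,w)]+J(y,[x,z],w)+J(y,z,[x,w]),$$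 $$J(x,y,z)+J(y,x,z)=-[S(x,y),z],$$ $$J(x,y,z)+J(x,z,y)=[x,S(y,z)]-S([x,y],z)-S(y,[x,z]),$$ $$S(x,[y,z])=S([y,z],x).$$ Here a chain homotopy $h$ from $f$ to $g$ satisfies $dh+hd=f-g$. The algebra is semistrict if $S=0$ and hemistrict if $J=0$. A homomorphism $L\to L'$ is a chain map $\phi=(\phi_0,\phi_1)$ with a chain homotopy $\Phi\colon L\otimes L\to L'$ from $x\otimes y\mapsto[\phi(x),\phi(y)]'$ to $x\otimes y\mapsto\phi([x,y])$ such that for all $x,y,z\in L_0$ $$S'(\phi_0x,\phi_0y)-\phi_1S(x,y)=\Phi(x,y)+\Phi(y,x),$$ $$J'(\phi_0x,\phi_0y,\phi_0z)-\phi_1J(x,y,z)=[\phi_0x,\Phi(y,z)]'-[\phi_0y,\Phi(x,z)]'-[\Phi(x,y),\phi_0z]'-\Phi([x,y],z)-\Phi(y,[x,z])+\Phi(x,[y,z]).$$ The composite of $(\phi,\Phi)\colon L\to L'$ and $(\psi,\Psi)\colon L'\to L''$ is $\psi\circ\phi$ with homotopy $\Psi(\phi_0x,\phi_0y)+\psi_1\Phi(x,y)$;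 the identity of $L$ is the identity chain map with zero homotopy; an isomorphism is a homomorphism with a two-sided inverse. Theorem. For a 2-plectic manifold $(M,\omega)$ the following are weak Lie 2-algebras on the complex $C^\infty(M)\xrightarrow{d}\mathrm{Ham}(M)$, where $\alpha,\beta,\gamma\in\mathrm{Ham}(M)$ and $f\in C^\infty(M)$: (1) $\mathrm{Lie}(M,\omega)$, which is semistrict, with $[\alpha,\beta]=\iota_{v_\beta}\iota_{v_\alpha}\omega=\omega(v_\alpha,v_\beta,\cdot)$, $[\alpha,f]=[f,\alpha]=0$, $S=0$, $J(\alpha,\beta,\gamma)=\omega(v_\gamma,v_\beta,v_\alpha)$; (2) $\mathrm{Leib}(M,\omega)$, which is hemistrict, with $[\alpha,\beta]=\mathcal L_{v_\alpha}\beta$, $[\alpha,f]=\mathcal L_{v_\alpha}f$, $[f,\alpha]=0$, $S(\alpha,\beta)=\iota_{v_\alpha}\beta+\iota_{v_\beta}\alpha$, $J=0$. The identity chain map of $C^\infty(M)\xrightarrow{d}\mathrm{Ham}(M)$ together with the homotopy $\Phi(\alpha,\beta)=\iota_{v_\alpha}\beta$ is an isomorphism $\mathrm{Lie}(M,\omega)\to\mathrm{Leib}(M,\omega)$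 of weak Lie 2-algebras; in particular the two are isomorphic. -/

import Mathlib

open Set Topology
open scoped Manifold ContDiff

/-! ## Weak Lie 2-algebras -/

/-- A weak Lie 2-algebra on the 2-term chain complex `d : V₁ → V₀` of vector spaces over `K`.

The structure maps on tensor powers of the complex are given by their components: a chain map
`L ⊗ L → L` by its components of total degree `0` and `1`, a chain homotopy into `L` (a map of
degree `1`) by its component in total degree `0`, all others being zero for degree reasons.
A chain homotopy `h` from `f` to `g` satisfies `d h + h d = f - g`. -/
@[ext]
structure WeakLieTwoAlgebra (K V₁ V₀ : Type*) [Field K] [AddCommGroup V₁] [Module K V₁]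
    [AddCommGroup V₀] [Module K V₀] where
  /-- the differential -/
  d : V₁ →ₗ[K] V₀
  /-- the bracket on `L₀ ⊗ L₀` -/
  br : V₀ →ₗ[K] V₀ →ₗ[K] V₀
  /-- the bracket on `L₀ ⊗ L₁` -/
  brL : V₀ →ₗ[K] V₁ →ₗ[K] V₁
  /-- the bracket on `L₁ ⊗ L₀` -/
  brR : V₁ →ₗ[K] V₀ →ₗ[K] V₁
  /-- the alternator -/
  S : V₀ →ₗ[K] V₀ →ₗ[K] V₁
  /-- the Jacobiator -/
  J : V₀ →ₗ[K] V₀ →ₗ[K] V₀ →ₗ[K] V₁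
  /-- the bracket is a chain map: on `L₀ ⊗ L₁` -/
  d_brL : ∀ x f, d (brL x f) = br x (d f)
  /-- the bracket is a chain map: on `L₁ ⊗ L₀` -/
  d_brR : ∀ f x, d (brR f x) = br (d f) x
  /-- the bracket is a chain map: on `L₁ ⊗ L₁` -/
  brL_d : ∀ f g, brL (d f) g = brR f (d g)
  /-- `S` is a chain homotopy from `x ⊗ y ↦ [x,y]` to `x ⊗ y ↦ -[y,x]`: degree `0` -/
  d_S : ∀ x y, d (S x y) = br x y - (- br y x)
  /-- the same on `L₀ ⊗ L₁` -/
  S_right : ∀ x f, S x (d f) = brL x f - (- brR f x)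
  /-- the same on `L₁ ⊗ L₀` -/
  S_left : ∀ f x, S (d f) x = brR f x - (- brL x f)
  /-- `J` is a chain homotopy from `x ⊗ y ⊗ z ↦ [x,[y,z]]` to
  `x ⊗ y ⊗ z ↦ [[x,y],z] + [y,[x,z]]`: degree `0` -/
  d_J : ∀ x y z, d (J x y z) = br x (br y z) - (br (br x y) z + br y (br x z))
  /-- the same on `L₁ ⊗ L₀ ⊗ L₀` -/
  J_left : ∀ f y z, J (d f) y z = brR f (br y z) - (brR (brR f y) z + brL y (brR f z))
  /-- the same on `L₀ ⊗ L₁ ⊗ L₀` -/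
  J_mid : ∀ x f z, J x (d f) z = brL x (brR f z) - (brR (brL x f) z + brR f (br x z))
  /-- the same on `L₀ ⊗ L₀ ⊗ L₁` -/
  J_right : ∀ x y f, J x y (d f) = brL x (brL y f) - (brL (br x y) f + brL y (brL x f))
  /-- coherence law of the Jacobiator -/
  jacobiator_coherence : ∀ x y z w,
    brL x (J y z w) + J x (br y z) w + J x z (br y w) + brR (J x y z) w + brL z (J x y w)
      = J x y (br z w) + J (br x y) z w + brL y (J x z w) + J y (br x z) w + J y z (br x w)
  /-- first compatibility of Jacobiator and alternator -/
  J_swap_left : ∀ x y z, J x y z + J y x z = - brR (S x y) z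
  /-- second compatibility of Jacobiator and alternator -/
  J_swap_right : ∀ x y z, J x y z + J x z y = brL x (S y z) - S (br x y) z - S y (br x z)
  /-- coherence law of the alternator -/
  S_br : ∀ x y z, S x (br y z) = S (br y z) x

namespace WeakLieTwoAlgebra

section Algebra

variable {K V₁ V₀ W₁ W₀ U₁ U₀ : Type*} [Field K]
  [AddCommGroup V₁] [Module K V₁] [AddCommGroup V₀] [Module K V₀]
  [AddCommGroup W₁] [Module K W₁] [AddCommGroup W₀] [Module K W₀]
  [AddCommGroup U₁] [Module K U₁] [AddCommGroup U₀] [Module K U₀]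

/-- A weak Lie 2-algebra is semi-strict if its alternator vanishes. -/
def IsSemistrict (A : WeakLieTwoAlgebra K V₁ V₀) : Prop := A.S = 0

/-- A weak Lie 2-algebra is hemi-strict if its Jacobiator vanishes. -/
def IsHemistrict (A : WeakLieTwoAlgebra K V₁ V₀) : Prop := A.J = 0

/-- A homomorphism of weak Lie 2-algebras: a chain map `(φ₀, φ₁)` together with a chain homotopy
`Φ` from `x ⊗ y ↦ [φ x, φ y]'` to `x ⊗ y ↦ φ [x, y]`, satisfying two coherence laws. -/
@[ext]
structure Hom (A : WeakLieTwoAlgebra K V₁ V₀) (B : WeakLieTwoAlgebra K W₁ W₀) where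
  /-- the chain map in degree `0` -/
  φ₀ : V₀ →ₗ[K] W₀
  /-- the chain map in degree `1` -/
  φ₁ : V₁ →ₗ[K] W₁
  /-- the homotopy -/
  Φ : V₀ →ₗ[K] V₀ →ₗ[K] W₁
  comm_d : ∀ f, B.d (φ₁ f) = φ₀ (A.d f)
  /-- the homotopy identity on `L₀ ⊗ L₀` -/
  d_Φ : ∀ x y, B.d (Φ x y) = B.br (φ₀ x) (φ₀ y) - φ₀ (A.br x y)
  /-- the homotopy identity on `L₀ ⊗ L₁` -/
  Φ_right : ∀ x f, Φ x (A.d f) = B.brL (φ₀ x) (φ₁ f) - φ₁ (A.brL x f)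
  /-- the homotopy identity on `L₁ ⊗ L₀` -/
  Φ_left : ∀ f x, Φ (A.d f) x = B.brR (φ₁ f) (φ₀ x) - φ₁ (A.brR f x)
  /-- compatibility with the alternators -/
  alternator : ∀ x y, B.S (φ₀ x) (φ₀ y) - φ₁ (A.S x y) = Φ x y + Φ y x
  /-- compatibility with the Jacobiators -/
  jacobiator : ∀ x y z, B.J (φ₀ x) (φ₀ y) (φ₀ z) - φ₁ (A.J x y z)
    = B.brL (φ₀ x) (Φ y z) - B.brL (φ₀ y) (Φ x z) - B.brR (Φ x y) (φ₀ z)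
      - Φ (A.br x y) z - Φ y (A.br x z) + Φ x (A.br y z)

namespace Hom

/-- The identity homomorphism. -/
def id (A : WeakLieTwoAlgebra K V₁ V₀) : Hom A A where
  φ₀ := LinearMap.id
  φ₁ := LinearMap.id
  Φ := 0
  comm_d := by simp
  d_Φ := by simp
  Φ_right := by simp
  Φ_left := by simp
  alternator := by simp
  jacobiator := by simp

variable {A : WeakLieTwoAlgebra K V₁ V₀} {B : WeakLieTwoAlgebra K W₁ W₀}
  {C : WeakLieTwoAlgebra K U₁ U₀}

/-- Composition of homomorphisms: the chain maps are composed, and the homotopy of the composite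
is the pasting `Ψ (φ₀ x) (φ₀ y) + ψ₁ (Φ x y)`. -/
def comp (G : Hom B C) (F : Hom A B) : Hom A C where
  φ₀ := G.φ₀ ∘ₗ F.φ₀
  φ₁ := G.φ₁ ∘ₗ F.φ₁
  Φ := G.Φ.compl₁₂ F.φ₀ F.φ₀ + F.Φ.compr₂ G.φ₁
  comm_d f := by simp [G.comm_d, F.comm_d]
  d_Φ x y := by simp [G.d_Φ, G.comm_d, F.d_Φ]
  Φ_right x f := by simp [← F.comm_d, G.Φ_right, F.Φ_right]
  Φ_left f x := by simp [← F.comm_d, G.Φ_left, F.Φ_left]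
  alternator x y := by
    have h1 := G.alternator (F.φ₀ x) (F.φ₀ y)
    have h2 := congrArg G.φ₁ (F.alternator x y)
    simp only [map_sub, map_add] at h2
    simp only [LinearMap.comp_apply, LinearMap.add_apply, LinearMap.compl₁₂_apply,
      LinearMap.compr₂_apply]
    linear_combination (norm := abel) h1 + h2
  jacobiator x y z := by
    have h1 := G.jacobiator (F.φ₀ x) (F.φ₀ y) (F.φ₀ z)
    have h2 := congrArg G.φ₁ (F.jacobiator x y z)
    have e1 := G.Φ_right (F.φ₀ x) (F.Φ y z)
    have e2 := G.Φ_right (F.φ₀ y) (F.Φ x z)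
    have e3 := G.Φ_left (F.Φ x y) (F.φ₀ z)
    simp only [F.d_Φ, map_sub, map_add, LinearMap.sub_apply] at h2 e1 e2 e3
    simp only [LinearMap.comp_apply, LinearMap.add_apply, LinearMap.compl₁₂_apply,
      LinearMap.compr₂_apply, map_add]
    linear_combination (norm := abel) h1 + h2 - e2 + e1 - e3

/-- An isomorphism of weak Lie 2-algebras is a homomorphism with a two-sided inverse. -/
def IsIso (F : Hom A B) : Prop :=
  ∃ G : Hom B A, G.comp F = Hom.id A ∧ F.comp G = Hom.id B

end Hom

end Algebra

end WeakLieTwoAlgebra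

/-! ## Differential forms on a manifold modelled on `E` -/

noncomputable section

namespace Plectic

section Forms

variable {E : Type*} [NormedAddCommGroup E] [NormedSpace ℝ E]
  {M : Type*} [TopologicalSpace M] [ChartedSpace E M]

variable (E M) in
/-- (Not necessarily smooth) differential `k`-forms on `M`. -/
abbrev Form (k : ℕ) : Type _ :=
  (x : M) → (TangentSpace 𝓘(ℝ, E) x) [⋀^Fin k]→L[ℝ] ℝ

/-- The pullback of a form to the model space along the inverse of the preferred chart at `x`
(meaningful on the target of that chart). -/
def chartForm {k : ℕ} (Ω : Form E M k) (x : M) : E → E [⋀^Fin k]→L[ℝ] ℝ := fun y =>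
  (Ω ((extChartAt 𝓘(ℝ, E) x).symm y)).compContinuousLinearMap
    (mfderiv 𝓘(ℝ, E) 𝓘(ℝ, E) (extChartAt 𝓘(ℝ, E) x).symm y : E →L[ℝ] _)

/-- A form is smooth if it is smooth in the charts of `M`. -/
def IsSmoothForm {k : ℕ} (Ω : Form E M k) : Prop :=
  ∀ x : M, ContDiffOn ℝ ∞ (chartForm Ω x) (extChartAt 𝓘(ℝ, E) x).target

/-- The exterior derivative of a form, computed at `x` in the chart at `x`. -/
def extDer {k : ℕ} (Ω : Form E M k) : Form E M (k + 1) := fun x =>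
  (extDeriv (chartForm Ω x) (extChartAt 𝓘(ℝ, E) x x)).compContinuousLinearMap
    (mfderiv 𝓘(ℝ, E) 𝓘(ℝ, E) (extChartAt 𝓘(ℝ, E) x) x : _ →L[ℝ] E)

/-- The differential of a function, as a `1`-form. -/
def dFun (f : M → ℝ) : Form E M 1 := fun x =>
  ContinuousAlternatingMap.ofSubsingleton ℝ (TangentSpace 𝓘(ℝ, E) x) ℝ (0 : Fin 1)
    (mfderiv 𝓘(ℝ, E) 𝓘(ℝ, ℝ) f x : _ →L[ℝ] ℝ)

/-! Elementary linearity, needed for Hamiltonian forms to make up a vector space. -/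

lemma chartForm_add {k : ℕ} (α β : Form E M k) (x : M) :
    chartForm (α + β) x = chartForm α x + chartForm β x := rfl

lemma chartForm_smul {k : ℕ} (c : ℝ) (α : Form E M k) (x : M) :
    chartForm (c • α) x = c • chartForm α x := rfl

lemma IsSmoothForm.differentiableAt {k : ℕ} {α : Form E M k} (h : IsSmoothForm α) (x : M) :
    DifferentiableAt ℝ (chartForm α x) (extChartAt 𝓘(ℝ, E) x x) :=
  ((h x).contDiffAt ((isOpen_extChartAt_target x).mem_nhds
    (mem_extChartAt_target x))).differentiableAt (by simp)

lemma extDer_add {k : ℕ} {α β : Form E M k} (hα : IsSmoothForm α) (hβ : IsSmoothForm β) :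
    extDer (α + β) = extDer α + extDer β := by
  funext x
  simp only [extDer, chartForm_add, Pi.add_apply,
    extDeriv_add (hα.differentiableAt x) (hβ.differentiableAt x)]
  rfl

lemma extDer_smul {k : ℕ} (c : ℝ) (α : Form E M k) :
    extDer (c • α) = c • extDer α := by
  funext x
  simp only [extDer, chartForm_smul, Pi.smul_apply, extDeriv_smul]
  rfl

/-- The interior product `ι_v η = η(v, ·, …, ·)` of a tangent vector with an alternating form. -/
def interAt {k : ℕ} {x : M} (v : TangentSpace 𝓘(ℝ, E) x)
    (η : (TangentSpace 𝓘(ℝ, E) x) [⋀^Fin (k + 1)]→L[ℝ] ℝ) :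
    (TangentSpace 𝓘(ℝ, E) x) [⋀^Fin k]→L[ℝ] ℝ :=
  (ContinuousAlternatingMap.curryLeft (E := E) η) v

lemma interAt_apply {k : ℕ} {x : M} (v : TangentSpace 𝓘(ℝ, E) x)
    (η : (TangentSpace 𝓘(ℝ, E) x) [⋀^Fin (k + 1)]→L[ℝ] ℝ)
    (u : Fin k → TangentSpace 𝓘(ℝ, E) x) :
    interAt v η u = η (Matrix.vecCons v u) := rfl

variable [IsManifold 𝓘(ℝ, E) ∞ M]

variable (E M) in
/-- Smooth vector fields on `M`. -/
abbrev VField : Type _ := Cₛ^∞⟮𝓘(ℝ, E); E, (TangentSpace 𝓘(ℝ, E) : M → Type _)⟯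

/-- The interior product `ι_X Ω = Ω(X, ·, …, ·)`. -/
def inter {k : ℕ} (X : VField E M) (Ω : Form E M (k + 1)) : Form E M k := fun x =>
  interAt (X x) (Ω x)

/-- The interior product of a `1`-form, as a function. -/
def interOne (X : VField E M) (β : Form E M 1) : M → ℝ := fun x => β x ![X x]

/-- The Lie derivative of a function. -/
def lieFun (X : VField E M) (f : M → ℝ) : M → ℝ := interOne X (dFun f)

/-- The Lie derivative of a `1`-form, `L_X β = d ι_X β + ι_X d β`. -/
def lieOne (X : VField E M) (β : Form E M 1) : Form E M 1 :=
  dFun (interOne X β) + inter X (extDer β)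

/-- An `n`-plectic structure: a smooth, closed, nondegenerate `(n+1)`-form. -/
structure IsPlectic (n : ℕ) (Ω : Form E M (n + 1)) : Prop where
  smooth : IsSmoothForm Ω
  closed : extDer Ω = 0
  nondegenerate : ∀ (x : M) (v : TangentSpace 𝓘(ℝ, E) x), interAt v (Ω x) = 0 → v = 0

lemma inter_add {k : ℕ} (v w : VField E M) (Ω : Form E M (k + 1)) :
    inter (v + w) Ω = inter v Ω + inter w Ω := by
  funext x
  exact map_add (ContinuousAlternatingMap.curryLeft (E := E) (Ω x)) (v x) (w x)

lemma inter_smul {k : ℕ} (c : ℝ) (v : VField E M) (Ω : Form E M (k + 1)) :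
    inter (c • v) Ω = c • inter v Ω := by
  funext x
  exact map_smul (ContinuousAlternatingMap.curryLeft (E := E) (Ω x)) c (v x)

lemma inter_zero {k : ℕ} (Ω : Form E M (k + 1)) : inter (0 : VField E M) Ω = 0 := by
  simpa using inter_smul (0 : ℝ) (0 : VField E M) Ω

/-- The vector space of Hamiltonian forms of a `(k+2)`-form `Ω`: the smooth `k`-forms `α` with
`dα = -ι_v Ω` for some smooth vector field `v`. -/
def Ham {k : ℕ} (Ω : Form E M (k + 2)) : Submodule ℝ (Form E M k) where
  carrier := {α | IsSmoothForm α ∧ ∃ v : VField E M, extDer α = - inter v Ω}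
  zero_mem' := by
    have h0 : IsSmoothForm (0 : Form E M k) := fun x => contDiffOn_const (c := 0)
    refine ⟨h0, 0, ?_⟩
    have h := extDer_smul (0 : ℝ) (0 : Form E M k)
    simp only [zero_smul] at h
    rw [h, inter_zero, neg_zero]
  add_mem' := by
    rintro α β ⟨hα, v, hv⟩ ⟨hβ, w, hw⟩
    refine ⟨fun x => (hα x).add (hβ x), v + w, ?_⟩
    rw [extDer_add hα hβ, hv, hw, inter_add, neg_add]
  smul_mem' := by
    rintro c α ⟨hα, v, hv⟩
    refine ⟨fun x => (hα x).const_smul c, c • v, ?_⟩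
    rw [extDer_smul, hv, inter_smul, smul_neg]

/-- The Hamiltonian vector field `v_α` of a Hamiltonian form `α`. -/
def hamVF {k : ℕ} {Ω : Form E M (k + 2)} (α : Ham Ω) : VField E M := α.2.2.choose

lemma hamVF_spec {k : ℕ} {Ω : Form E M (k + 2)} (α : Ham Ω) :
    extDer (α : Form E M k) = - inter (hamVF α) Ω := α.2.2.choose_spec

/-- On an `n`-plectic manifold the Hamiltonian vector field is unique. -/
lemma hamVF_unique {k : ℕ} {Ω : Form E M (k + 2)} (hΩ : IsPlectic (k + 1) Ω) (α : Ham Ω)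
    (v : VField E M) (hv : extDer (α : Form E M k) = - inter v Ω) : v = hamVF α := by
  have e : inter v Ω = inter (hamVF α) Ω := neg_injective (hv.symm.trans (hamVF_spec α))
  have h : inter (v + (-1 : ℝ) • hamVF α) Ω = 0 := by
    rw [inter_add, inter_smul, e]
    funext x
    exact (congrArg _ (neg_one_smul ℝ _)).trans (add_neg_cancel _)
  ext x
  have hx : v x + (-1 : ℝ) • hamVF α x = 0 := hΩ.nondegenerate x _ (congrFun h x)
  rw [neg_one_smul] at hx
  exact add_neg_eq_zero.1 hx

/-- `A` is the Lie 2-algebra `Lie(M, Ω)` on the complex `d : C^∞(M) → Ham(M)`: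
the bracket is `{α, β} = ι_{v_β} ι_{v_α} Ω = Ω(v_α, v_β, ·)` in degree `0` and zero otherwise, the
alternator is zero, and the Jacobiator is `Ω(v_γ, v_β, v_α)`. -/
structure IsLie {Ω : Form E M 3}
    (A : WeakLieTwoAlgebra ℝ C^∞⟮𝓘(ℝ, E), M; ℝ⟯ (Ham Ω)) : Prop where
  d_eq : ∀ f, (A.d f : Form E M 1) = dFun f
  br_eq : ∀ α β, (A.br α β : Form E M 1) = inter (hamVF β) (inter (hamVF α) Ω)
  brL_eq : ∀ α f, A.brL α f = 0
  brR_eq : ∀ f α, A.brR f α = 0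
  S_eq : ∀ α β, A.S α β = 0
  J_eq : ∀ α β γ (x : M), A.J α β γ x = Ω x ![hamVF γ x, hamVF β x, hamVF α x]

/-- `B` is the weak Lie 2-algebra `Leib(M, Ω)` on the complex `d : C^∞(M) → Ham(M)`:
the bracket is `L_{v_α} β` in degree `0`, and `[α, f] = L_{v_α} f`, `[f, α] = 0` in degree `1`, the
alternator is `ι_{v_α} β + ι_{v_β} α`, and the Jacobiator is zero. -/
structure IsLeib {Ω : Form E M 3}
    (B : WeakLieTwoAlgebra ℝ C^∞⟮𝓘(ℝ, E), M; ℝ⟯ (Ham Ω)) : Prop where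
  d_eq : ∀ f, (B.d f : Form E M 1) = dFun f
  br_eq : ∀ α β, (B.br α β : Form E M 1) = lieOne (hamVF α) β
  brL_eq : ∀ α f (x : M), B.brL α f x = lieFun (hamVF α) f x
  brR_eq : ∀ f α, B.brR f α = 0
  S_eq : ∀ α β (x : M),
    B.S α β x = interOne (hamVF α) (β : Form E M 1) x + interOne (hamVF β) (α : Form E M 1) x
  J_eq : ∀ α β γ, B.J α β γ = 0

end Forms

end Plectic

end

/-! Both structures come from one skew bracket `{α, β} = Ω(v_α, v_β, ·)` and one pairing `ι_{v_α}
β`. Since `dβ = -ι_{v_β} Ω`, Cartan's formula gives `L_{v_α} β = {α, β} + d ι_{v_α} β`: the two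
brackets differ by an exact term, whose primitive is the homotopy.

The geometric input is that Hamiltonian fields preserve `Ω`: `ι_v Ω` is exact and `Ω` is closed, so
`L_v Ω = 0`. In coordinates this is `fderiv_of_closed`, which replaces a derivative of `Ω` along `v`
by derivatives of `v`. Inserted into `dΩ = 0`, it shows that `{α, β}` has Hamiltonian field `[v_α,
v_β]` (`extDer_inter_inter`), that the Jacobi defect of the bracket is `d` of `Ω(v_γ, v_β, v_α)`
(`dFun_contraction`), and that this Jacobiator is coherent (`vfBracket_sum`). The remaining input is
Cartan's formula for `dγ` (`lieFun_interOne_sub`).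

These identities form `ContractionData`, from which the two algebras and the homomorphism follow by
pure algebra. A homomorphism over the identity chain map is inverted by negating its homotopy.
Uniqueness holds because the defining formulas fix every structure map. -/

section LocalCalculus

variable {E : Type*} [NormedAddCommGroup E] [NormedSpace ℝ E]

/-! ### Alternating forms and exterior derivatives on a normed space -/

namespace ContinuousAlternatingMap

lemma apply_swap₃_left (T : E [⋀^Fin 3]→L[ℝ] ℝ) (a b c : E) :
    T ![b, a, c] = - T ![a, b, c] := by
  have h : T (![a, b, c] ∘ Equiv.swap 0 1) = - T ![a, b, c] := T.map_swap _ (by decide)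
  rw [← h]; congr 1; funext i; fin_cases i <;> rfl

lemma apply_swap₃_right (T : E [⋀^Fin 3]→L[ℝ] ℝ) (a b c : E) :
    T ![a, c, b] = - T ![a, b, c] := by
  have h : T (![a, b, c] ∘ Equiv.swap 1 2) = - T ![a, b, c] := T.map_swap _ (by decide)
  rw [← h]; congr 1; funext i; fin_cases i <;> rfl

lemma apply_sub₃ (T : E [⋀^Fin 3]→L[ℝ] ℝ) (a a' b c : E) :
    T ![a - a', b, c] = T ![a, b, c] - T ![a', b, c] :=
  congrArg (fun S => S ![b, c]) (map_sub T.curryLeft a a')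

lemma apply_sub₁ (T : E [⋀^Fin 1]→L[ℝ] ℝ) (a a' : E) :
    T ![a - a'] = T ![a] - T ![a'] :=
  congrArg (fun S => S ![]) (map_sub T.curryLeft a a')

lemma ext_fin_one {S T : E [⋀^Fin 1]→L[ℝ] ℝ} (h : ∀ a, S ![a] = T ![a]) : S = T := by
  ext u
  have : u = ![u 0] := by funext i; fin_cases i; rfl
  rw [this, h]

lemma ext_fin_two {S T : E [⋀^Fin 2]→L[ℝ] ℝ} (h : ∀ a b, S ![a, b] = T ![a, b]) : S = T := by
  ext u
  have : u = ![u 0, u 1] := by funext i; fin_cases i <;> rfl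
  rw [this, h]

end ContinuousAlternatingMap

open ContinuousAlternatingMap VectorField

lemma extDeriv_apply₁ (η : E → E [⋀^Fin 1]→L[ℝ] ℝ) (y a b : E) :
    extDeriv η y ![a, b] = fderiv ℝ η y a ![b] - fderiv ℝ η y b ![a] := by
  have h0 : (0 : Fin 2).removeNth ![a, b] = ![b] := by funext i; fin_cases i; rfl
  have h1 : (1 : Fin 2).removeNth ![a, b] = ![a] := by funext i; fin_cases i; rfl
  simp [extDeriv, alternatizeUncurryFin_apply, Fin.sum_univ_two, h0, h1, sub_eq_add_neg]

lemma extDeriv_apply₂ (η : E → E [⋀^Fin 2]→L[ℝ] ℝ) (y a b c : E) :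
    extDeriv η y ![a, b, c] = fderiv ℝ η y a ![b, c] - fderiv ℝ η y b ![a, c]
      + fderiv ℝ η y c ![a, b] := by
  have h0 : (0 : Fin 3).removeNth ![a, b, c] = ![b, c] := by funext i; fin_cases i <;> rfl
  have h1 : (1 : Fin 3).removeNth ![a, b, c] = ![a, c] := by funext i; fin_cases i <;> rfl
  have h2 : (2 : Fin 3).removeNth ![a, b, c] = ![a, b] := by funext i; fin_cases i <;> rfl
  simp [extDeriv, alternatizeUncurryFin_apply, Fin.sum_univ_three, h0, h1, h2, sub_eq_add_neg]

lemma extDeriv_apply₃ (η : E → E [⋀^Fin 3]→L[ℝ] ℝ) (y a b c d : E) :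
    extDeriv η y ![a, b, c, d] = fderiv ℝ η y a ![b, c, d] - fderiv ℝ η y b ![a, c, d]
      + fderiv ℝ η y c ![a, b, d] - fderiv ℝ η y d ![a, b, c] := by
  have h0 : (0 : Fin 4).removeNth ![a, b, c, d] = ![b, c, d] := by
    funext i; fin_cases i <;> rfl
  have h1 : (1 : Fin 4).removeNth ![a, b, c, d] = ![a, c, d] := by
    funext i; fin_cases i <;> rfl
  have h2 : (2 : Fin 4).removeNth ![a, b, c, d] = ![a, b, d] := by
    funext i; fin_cases i <;> rfl
  have h3 : (3 : Fin 4).removeNth ![a, b, c, d] = ![a, b, c] := by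
    funext i; fin_cases i <;> rfl
  simp [extDeriv, alternatizeUncurryFin_apply, Fin.sum_univ_four, h0, h1, h2, h3,
    sub_eq_add_neg, pow_succ]

lemma hasFDerivAt_curryLeft {k : ℕ} {η : E → E [⋀^Fin (k + 1)]→L[ℝ] ℝ} {y : E}
    (hη : DifferentiableAt ℝ η y) : HasFDerivAt (fun z => (η z).curryLeft)
      ((curryLeftLI (𝕜 := ℝ) (E := E) (F := ℝ) (n := k)).toContinuousLinearMap ∘L
        fderiv ℝ η y) y := by
  have h1 := (curryLeftLI (𝕜 := ℝ) (E := E) (F := ℝ)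
    (n := k)).toContinuousLinearMap.hasFDerivAt (x := η y)
  exact HasFDerivAt.comp (𝕜 := ℝ) (E := E) (F := E [⋀^Fin (k + 1)]→L[ℝ] ℝ)
    (G := E →L[ℝ] E [⋀^Fin k]→L[ℝ] ℝ) (f := η) (f' := fderiv ℝ η y) y h1 hη.hasFDerivAt

lemma hasFDerivAt_curryLeft_apply {k : ℕ} {η : E → E [⋀^Fin (k + 1)]→L[ℝ] ℝ} {V : E → E} {y : E}
    (hη : DifferentiableAt ℝ η y) (hV : DifferentiableAt ℝ V y) :
    HasFDerivAt (fun z => (η z).curryLeft (V z))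
      ((η y).curryLeft ∘L fderiv ℝ V y +
        ((curryLeftLI (𝕜 := ℝ) (E := E) (F := ℝ) (n := k)).toContinuousLinearMap ∘L
          fderiv ℝ η y).flip (V y)) y := by
  exact (hasFDerivAt_curryLeft hη).clm_apply hV.hasFDerivAt

lemma fderiv_curryLeft_apply {k : ℕ} {η : E → E [⋀^Fin (k + 1)]→L[ℝ] ℝ} {V : E → E} {y : E}
    (hη : DifferentiableAt ℝ η y) (hV : DifferentiableAt ℝ V y) (a : E) :
    fderiv ℝ (fun z => (η z).curryLeft (V z)) y a =
      (fderiv ℝ η y a).curryLeft (V y) + (η y).curryLeft (fderiv ℝ V y a) := by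
  rw [(hasFDerivAt_curryLeft_apply hη hV).fderiv, add_comm]
  rfl

lemma fderiv_apply₁ {η : E → E [⋀^Fin 1]→L[ℝ] ℝ} {V : E → E} {y : E}
    (hη : DifferentiableAt ℝ η y) (hV : DifferentiableAt ℝ V y) (a : E) :
    fderiv ℝ (fun z => η z ![V z]) y a = fderiv ℝ η y a ![V y] + η y ![fderiv ℝ V y a] := by
  -- The value of a 1-form on `V z` is the 0-form obtained by contraction, evaluated on the empty
  -- tuple; that tuple is constant.
  have h := fderiv_continuousAlternatingMap_apply_const_apply
    (hasFDerivAt_curryLeft_apply hη hV).differentiableAt ![] a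
  rw [fderiv_curryLeft_apply hη hV] at h
  exact h

/-- Cartan's formula for the exterior derivative of a `1`-form. -/
lemma fderiv_apply₁_sub {η : E → E [⋀^Fin 1]→L[ℝ] ℝ} {V W : E → E} {y : E}
    (hη : DifferentiableAt ℝ η y) (hV : DifferentiableAt ℝ V y) (hW : DifferentiableAt ℝ W y) :
    fderiv ℝ (fun z => η z ![W z]) y (V y) - fderiv ℝ (fun z => η z ![V z]) y (W y)
      = extDeriv η y ![V y, W y] + η y ![lieBracket ℝ V W y] := by
  rw [fderiv_apply₁ hη hV, fderiv_apply₁ hη hW, extDeriv_apply₁, lieBracket, apply_sub₁]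
  ring

/-! ### Closed 3-forms and the fields that preserve them, in coordinates -/

section ThreeForm

variable {Ω : E → E [⋀^Fin 3]→L[ℝ] ℝ} {U V W Z : E → E} {y : E}

/-- A closed form whose contraction with `V` is closed is invariant under `V`. -/
lemma fderiv_of_closed (hΩ : DifferentiableAt ℝ Ω y) (hV : DifferentiableAt ℝ V y)
    (hc : extDeriv Ω y = 0) (hcV : extDeriv (fun z => (Ω z).curryLeft (V z)) y = 0) (a b c : E) :
    fderiv ℝ Ω y (V y) ![a, b, c] = - (Ω y ![fderiv ℝ V y a, b, c]
      - Ω y ![fderiv ℝ V y b, a, c] + Ω y ![fderiv ℝ V y c, a, b]) := by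
  -- This is `L_V = ι_V d + d ι_V` in coordinates: in the sum of the two expansions the derivatives
  -- of `Ω` along `a`, `b`, `c` cancel.
  have h1 := extDeriv_apply₃ Ω y (V y) a b c
  have h2 := extDeriv_apply₂ (fun z => (Ω z).curryLeft (V z)) y a b c
  rw [hc] at h1
  rw [hcV] at h2
  simp only [fderiv_curryLeft_apply hΩ hV, ContinuousAlternatingMap.add_apply,
    curryLeft_apply_apply] at h1 h2
  have e1 : (0 : E [⋀^Fin 4]→L[ℝ] ℝ) ![V y, a, b, c] = 0 := rfl
  have e2 : (0 : E [⋀^Fin 3]→L[ℝ] ℝ) ![a, b, c] = 0 := rfl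
  linear_combination -h1 - h2 + e1 + e2

/-- The contraction of `Ω` with two Hamiltonian fields is Hamiltonian, with field the Lie
bracket. -/
lemma extDeriv_curryLeft_curryLeft (hΩ : DifferentiableAt ℝ Ω y) (hV : DifferentiableAt ℝ V y)
    (hW : DifferentiableAt ℝ W y) (hc : extDeriv Ω y = 0)
    (hcV : extDeriv (fun z => (Ω z).curryLeft (V z)) y = 0)
    (hcW : extDeriv (fun z => (Ω z).curryLeft (W z)) y = 0) :
    extDeriv (fun z => ((Ω z).curryLeft (V z)).curryLeft (W z)) y
      = - (Ω y).curryLeft (lieBracket ℝ V W y) := by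
  refine ext_fin_two fun a b => ?_
  have hΩV := (hasFDerivAt_curryLeft_apply hΩ hV).differentiableAt
  rw [extDeriv_apply₁, fderiv_curryLeft_apply hΩV hW, fderiv_curryLeft_apply hΩV hW,
    fderiv_curryLeft_apply hΩ hV, fderiv_curryLeft_apply hΩ hV]
  -- Closedness trades the derivatives of `Ω` along `a` and `b` for those along `V` and `W`, which
  -- invariance turns into derivatives of the fields.
  have h := extDeriv_apply₃ Ω y (V y) (W y) a b
  rw [hc] at h
  rw [fderiv_of_closed hΩ hV hc hcV, fderiv_of_closed hΩ hW hc hcW] at h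
  simp only [ContinuousAlternatingMap.add_apply, curryLeft_add, _root_.add_apply,
    ContinuousAlternatingMap.neg_apply, curryLeft_apply_apply, lieBracket] at h ⊢
  have e0 : (0 : E [⋀^Fin 4]→L[ℝ] ℝ) ![V y, W y, a, b] = 0 := rfl
  have e2 := apply_swap₃_left (Ω y) (V y) (fderiv ℝ W y a) b
  have e3 := apply_swap₃_left (Ω y) (V y) (fderiv ℝ W y b) a
  have e5 := apply_sub₃ (Ω y) (fderiv ℝ W y (V y)) (fderiv ℝ V y (W y)) a b
  linear_combination -h + e0 + e2 - e3 + e5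

lemma fderiv_apply₃ (hΩ : DifferentiableAt ℝ Ω y) (hU : DifferentiableAt ℝ U y)
    (hV : DifferentiableAt ℝ V y) (hW : DifferentiableAt ℝ W y) (a : E) :
    fderiv ℝ (fun z => Ω z ![U z, V z, W z]) y a = fderiv ℝ Ω y a ![U y, V y, W y]
      + Ω y ![fderiv ℝ U y a, V y, W y] - Ω y ![fderiv ℝ V y a, U y, W y]
      + Ω y ![fderiv ℝ W y a, U y, V y] := by
  have h1 := (hasFDerivAt_curryLeft_apply hΩ hU).differentiableAt
  have h2 := (hasFDerivAt_curryLeft_apply h1 hV).differentiableAt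
  have h := fderiv_apply₁ h2 hW a
  rw [fderiv_curryLeft_apply h1 hV, fderiv_curryLeft_apply hΩ hU] at h
  simp only [ContinuousAlternatingMap.add_apply, curryLeft_add, _root_.add_apply,
    curryLeft_apply_apply] at h
  have e1 := apply_swap₃_left (Ω y) (U y) (fderiv ℝ V y a) (W y)
  have e2 := apply_swap₃_left (Ω y) (U y) (fderiv ℝ W y a) (V y)
  have e3 := apply_swap₃_right (Ω y) (U y) (V y) (fderiv ℝ W y a)
  linear_combination h + e1 - e2 + e3

/-- The differential of `Ω(U, V, W)` for Hamiltonian fields `U`, `V`, `W`. -/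
lemma fderiv_apply₃_of_closed (hΩ : DifferentiableAt ℝ Ω y) (hU : DifferentiableAt ℝ U y)
    (hV : DifferentiableAt ℝ V y) (hW : DifferentiableAt ℝ W y) (hc : extDeriv Ω y = 0)
    (hcU : extDeriv (fun z => (Ω z).curryLeft (U z)) y = 0)
    (hcV : extDeriv (fun z => (Ω z).curryLeft (V z)) y = 0)
    (hcW : extDeriv (fun z => (Ω z).curryLeft (W z)) y = 0) (a : E) :
    fderiv ℝ (fun z => Ω z ![U z, V z, W z]) y a = - Ω y ![lieBracket ℝ W V y, U y, a]
      + Ω y ![lieBracket ℝ W U y, V y, a] + Ω y ![lieBracket ℝ U V y, W y, a] := by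
  rw [fderiv_apply₃ hΩ hU hV hW]
  -- Closedness expresses the derivative of `Ω` along the arbitrary vector `a` by derivatives along
  -- `U`, `V`, `W`, where invariance applies.
  have h := extDeriv_apply₃ Ω y a (U y) (V y) (W y)
  rw [hc] at h
  rw [fderiv_of_closed hΩ hU hc hcU, fderiv_of_closed hΩ hV hc hcV,
    fderiv_of_closed hΩ hW hc hcW] at h
  have e0 : (0 : E [⋀^Fin 4]→L[ℝ] ℝ) ![a, U y, V y, W y] = 0 := rfl
  rw [apply_swap₃_right _ _ a (U y), apply_swap₃_right _ _ a (V y), apply_swap₃_right _ _ a (W y)]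
  simp only [lieBracket, apply_sub₃]
  linear_combination -h + e0

/-- The terms without derivatives in the Cartan formula for `dΩ` cancel on Hamiltonian fields. -/
lemma lieBracket_sum_of_closed (hΩ : DifferentiableAt ℝ Ω y) (hU : DifferentiableAt ℝ U y)
    (hV : DifferentiableAt ℝ V y) (hW : DifferentiableAt ℝ W y) (hZ : DifferentiableAt ℝ Z y)
    (hc : extDeriv Ω y = 0)
    (hcU : extDeriv (fun z => (Ω z).curryLeft (U z)) y = 0)
    (hcV : extDeriv (fun z => (Ω z).curryLeft (V z)) y = 0)
    (hcW : extDeriv (fun z => (Ω z).curryLeft (W z)) y = 0)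
    (hcZ : extDeriv (fun z => (Ω z).curryLeft (Z z)) y = 0) :
    Ω y ![lieBracket ℝ U V y, W y, Z y] - Ω y ![lieBracket ℝ U W y, V y, Z y]
      + Ω y ![lieBracket ℝ U Z y, V y, W y] + Ω y ![lieBracket ℝ V W y, U y, Z y]
      - Ω y ![lieBracket ℝ V Z y, U y, W y] + Ω y ![lieBracket ℝ W Z y, U y, V y] = 0 := by
  -- Invariance removes all four derivatives of `Ω`; the twelve terms left pair up into six Lie
  -- brackets.
  have h := extDeriv_apply₃ Ω y (U y) (V y) (W y) (Z y)
  rw [hc] at h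
  rw [fderiv_of_closed hΩ hU hc hcU, fderiv_of_closed hΩ hV hc hcV,
    fderiv_of_closed hΩ hW hc hcW, fderiv_of_closed hΩ hZ hc hcZ] at h
  have e0 : (0 : E [⋀^Fin 4]→L[ℝ] ℝ) ![U y, V y, W y, Z y] = 0 := rfl
  simp only [lieBracket, apply_sub₃]
  linear_combination -h + e0

end ThreeForm

end LocalCalculus

/-! ### Coordinate expressions of forms and vector fields -/

noncomputable section

namespace Plectic

open ContinuousAlternatingMap VectorField

section Charts

variable {E : Type*} [NormedAddCommGroup E] [NormedSpace ℝ E]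
  {M : Type*} [TopologicalSpace M] [ChartedSpace E M]

/-- The coordinate expression of a vector field in the preferred chart at `x`. -/
def chartVF (X : (x : M) → TangentSpace 𝓘(ℝ, E) x) (x : M) (y : E) : E :=
  mpullback 𝓘(ℝ, E) 𝓘(ℝ, E) (extChartAt 𝓘(ℝ, E) x).symm X y

lemma extChartAt_target_mem_nhds_self (x : M) :
    (extChartAt 𝓘(ℝ, E) x).target ∈ 𝓝 (extChartAt 𝓘(ℝ, E) x x) :=
  (isOpen_extChartAt_target x).mem_nhds (mem_extChartAt_target x)

variable [IsManifold 𝓘(ℝ, E) ∞ M]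

instance isManifold_one_of_infty : IsManifold 𝓘(ℝ, E) 1 M := .of_le (n := ∞) (by simp)

/-- The tangent space at `x` is identified with `E` through the preferred chart at `x`. Hence at the
centre of that chart, coordinate expressions agree with the intrinsic objects, and pointwise
identities on `M` reduce to identities on `E`. -/
lemma mfderiv_extChartAt_symm_self (x : M) :
    (mfderiv 𝓘(ℝ, E) 𝓘(ℝ, E) (extChartAt 𝓘(ℝ, E) x).symm (extChartAt 𝓘(ℝ, E) x x) : E →L[ℝ] E)
      = ContinuousLinearMap.id ℝ E := by
  have h := mfderivWithin_range_extChartAt_symm (I := 𝓘(ℝ, E)) (x := x)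
  rw [modelWithCornersSelf_coe, range_id, mfderivWithin_univ] at h
  exact h

lemma isInvertible_mfderiv_extChartAt_symm {x : M} {y : E}
    (hy : y ∈ (extChartAt 𝓘(ℝ, E) x).target) :
    (mfderiv 𝓘(ℝ, E) 𝓘(ℝ, E) (extChartAt 𝓘(ℝ, E) x).symm y).IsInvertible := by
  have h := isInvertible_mfderivWithin_extChartAt_symm (I := 𝓘(ℝ, E)) hy
  rwa [modelWithCornersSelf_coe, range_id, mfderivWithin_univ] at h

lemma chartForm_self {k : ℕ} (Ω : Form E M k) (x : M) :
    chartForm Ω x (extChartAt 𝓘(ℝ, E) x x) = Ω x := by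
  -- Going to the chart and back returns `x` only up to a propositional equality on which the type
  -- of `Ω z` depends; generalising the point allows substitution.
  have h : ∀ z : M, z = x →
      (Ω z).compContinuousLinearMap (ContinuousLinearMap.id ℝ E) = Ω x := by
    rintro z rfl; rfl
  have h' := h _ (extChartAt_to_inv (I := 𝓘(ℝ, E)) x)
  rw [← mfderiv_extChartAt_symm_self x] at h'
  exact h'

lemma chartVF_self (X : (x : M) → TangentSpace 𝓘(ℝ, E) x) (x : M) :
    chartVF X x (extChartAt 𝓘(ℝ, E) x x) = X x := by
  have h : ∀ z : M, z = x →
      (ContinuousLinearMap.id ℝ E).inverse (X z : E) = X x := by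
    rintro z rfl
    rw [ContinuousLinearMap.inverse_id]; rfl
  have h' := h _ (extChartAt_to_inv (I := 𝓘(ℝ, E)) x)
  rw [← mfderiv_extChartAt_symm_self x] at h'
  exact h'

lemma extDer_apply {k : ℕ} (Ω : Form E M k) (x : M) :
    extDer Ω x = extDeriv (chartForm Ω x) (extChartAt 𝓘(ℝ, E) x x) := by
  have h : (mfderiv 𝓘(ℝ, E) 𝓘(ℝ, E) (extChartAt 𝓘(ℝ, E) x) x : E →L[ℝ] E)
      = ContinuousLinearMap.id ℝ E := mfderiv_extChartAt_self
  have h' : (extDeriv (chartForm Ω x) (extChartAt 𝓘(ℝ, E) x x)).compContinuousLinearMap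
      (ContinuousLinearMap.id ℝ E) = extDeriv (chartForm Ω x) (extChartAt 𝓘(ℝ, E) x x) := rfl
  rw [← h] at h'
  exact h'

lemma mfderiv_symm_chartVF (X : (x : M) → TangentSpace 𝓘(ℝ, E) x) {x : M} {y : E}
    (hy : y ∈ (extChartAt 𝓘(ℝ, E) x).target) :
    mfderiv 𝓘(ℝ, E) 𝓘(ℝ, E) (extChartAt 𝓘(ℝ, E) x).symm y (chartVF (E := E) X x y)
      = X ((extChartAt 𝓘(ℝ, E) x).symm y) := by
  obtain ⟨e, he⟩ := isInvertible_mfderiv_extChartAt_symm hy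
  change mfderiv 𝓘(ℝ, E) 𝓘(ℝ, E) (extChartAt 𝓘(ℝ, E) x).symm y
    ((mfderiv 𝓘(ℝ, E) 𝓘(ℝ, E) (extChartAt 𝓘(ℝ, E) x).symm y).inverse _) = _
  rw [← he, ContinuousLinearMap.inverse_equiv]
  exact e.apply_symm_apply _

lemma chartForm_inter {k : ℕ} (X : VField E M) (Ω : Form E M (k + 1)) {x : M} {y : E}
    (hy : y ∈ (extChartAt 𝓘(ℝ, E) x).target) :
    chartForm (inter X Ω) x y = (chartForm Ω x y).curryLeft (chartVF X x y) := by
  ext u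
  have h := mfderiv_symm_chartVF X hy
  have h2 : chartForm (inter X Ω) x y u = Ω ((extChartAt 𝓘(ℝ, E) x).symm y)
    (Matrix.vecCons (X ((extChartAt 𝓘(ℝ, E) x).symm y))
      (fun i => mfderiv 𝓘(ℝ, E) 𝓘(ℝ, E) (extChartAt 𝓘(ℝ, E) x).symm y (u i))) := rfl
  rw [h2, ← h]
  refine congrArg (Ω ((extChartAt 𝓘(ℝ, E) x).symm y)) ?_
  funext i
  refine Fin.cases ?_ (fun j => ?_) i <;> rfl

lemma interOne_symm (X : VField E M) (β : Form E M 1) {x : M} {y : E}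
    (hy : y ∈ (extChartAt 𝓘(ℝ, E) x).target) :
    interOne X β ((extChartAt 𝓘(ℝ, E) x).symm y) = chartForm β x y ![chartVF X x y] := by
  have h := mfderiv_symm_chartVF X hy
  have h2 : interOne X β ((extChartAt 𝓘(ℝ, E) x).symm y) = β ((extChartAt 𝓘(ℝ, E) x).symm y)
    ![X ((extChartAt 𝓘(ℝ, E) x).symm y)] := rfl
  rw [h2, ← h]
  refine congrArg (β ((extChartAt 𝓘(ℝ, E) x).symm y)) ?_
  funext i
  fin_cases i
  rfl

lemma contDiffOn_chartVF [CompleteSpace E] (X : VField E M) (x : M) :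
    ContDiffOn ℝ ∞ (chartVF X x) (extChartAt 𝓘(ℝ, E) x).target := by
  intro y hy
  have hs := (contMDiffOn_extChartAt_symm (I := 𝓘(ℝ, E)) (n := ∞) x).contMDiffAt
    ((isOpen_extChartAt_target x).mem_nhds hy)
  have h := ContMDiffAt.mpullback_vectorField_preimage (m := ∞)
    (X.contMDiff ((extChartAt 𝓘(ℝ, E) x).symm y)) hs
    (isInvertible_mfderiv_extChartAt_symm hy) (by simp)
  have h2 := (contMDiff_snd_tangentBundle_modelSpace E 𝓘(ℝ, E)).contMDiffAt.comp y h
  exact h2.contDiffAt.contDiffWithinAt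

lemma mdifferentiableAt_extChartAt_symm {x : M} {y : E}
    (hy : y ∈ (extChartAt 𝓘(ℝ, E) x).target) :
    MDifferentiableAt 𝓘(ℝ, E) 𝓘(ℝ, E) (extChartAt 𝓘(ℝ, E) x).symm y := by
  have h := mdifferentiableWithinAt_extChartAt_symm (I := 𝓘(ℝ, E)) hy
  rwa [modelWithCornersSelf_coe, range_id, mdifferentiableWithinAt_univ] at h

lemma chartForm_dFun {f : M → ℝ} (hf : ContMDiff 𝓘(ℝ, E) 𝓘(ℝ, ℝ) ∞ f) {x : M} {y : E}
    (hy : y ∈ (extChartAt 𝓘(ℝ, E) x).target) :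
    chartForm (dFun f) x y = ContinuousAlternatingMap.ofSubsingleton ℝ E ℝ (0 : Fin 1)
      (fderiv ℝ (f ∘ (extChartAt 𝓘(ℝ, E) x).symm) y) := by
  have h := mfderiv_comp y (hf.mdifferentiableAt (by simp)) (mdifferentiableAt_extChartAt_symm hy)
  rw [mfderiv_eq_fderiv] at h
  rw [h]
  rfl

lemma contDiffOn_comp_symm {f : M → ℝ} (hf : ContMDiff 𝓘(ℝ, E) 𝓘(ℝ, ℝ) ∞ f) (x : M) :
    ContDiffOn ℝ ∞ (f ∘ (extChartAt 𝓘(ℝ, E) x).symm) (extChartAt 𝓘(ℝ, E) x).target := by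
  rw [← contMDiffOn_iff_contDiffOn]
  exact hf.comp_contMDiffOn (contMDiffOn_extChartAt_symm x)

omit [IsManifold 𝓘(ℝ, E) ∞ M] in
lemma contMDiff_of_contDiffOn_comp_symm {f : M → ℝ}
    (hf : ∀ x : M, ContDiffOn ℝ ∞ (f ∘ (extChartAt 𝓘(ℝ, E) x).symm)
      (extChartAt 𝓘(ℝ, E) x).target) : ContMDiff 𝓘(ℝ, E) 𝓘(ℝ, ℝ) ∞ f := by
  intro x
  have h := ((hf x).contDiffAt (extChartAt_target_mem_nhds_self x)).contMDiffAt.comp x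
    (contMDiffAt_extChartAt (I := 𝓘(ℝ, E)) (n := ∞) (x := x))
  refine h.congr_of_eventuallyEq ?_
  filter_upwards [extChartAt_source_mem_nhds (I := 𝓘(ℝ, E)) x] with z hz
  simp only [Function.comp_apply, (extChartAt 𝓘(ℝ, E) x).left_inv hz]

lemma dFun_apply {f : M → ℝ} (hf : ContMDiff 𝓘(ℝ, E) 𝓘(ℝ, ℝ) ∞ f) (x : M) :
    dFun f x = ContinuousAlternatingMap.ofSubsingleton ℝ E ℝ (0 : Fin 1)
      (fderiv ℝ (f ∘ (extChartAt 𝓘(ℝ, E) x).symm) (extChartAt 𝓘(ℝ, E) x x)) := by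
  rw [← chartForm_dFun hf (mem_extChartAt_target x), chartForm_self]

lemma mlieBracket_apply_chart (V W : (x : M) → TangentSpace 𝓘(ℝ, E) x) (x : M) :
    mlieBracket 𝓘(ℝ, E) V W x
      = lieBracket ℝ (chartVF V x) (chartVF W x) (extChartAt 𝓘(ℝ, E) x x) := by
  have h : (mfderiv 𝓘(ℝ, E) 𝓘(ℝ, E) (extChartAt 𝓘(ℝ, E) x) x : E →L[ℝ] E)
      = ContinuousLinearMap.id ℝ E := mfderiv_extChartAt_self
  have h' : (ContinuousLinearMap.id ℝ E).inverse (lieBracketWithin ℝ (chartVF V x)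
      (chartVF W x) univ (extChartAt 𝓘(ℝ, E) x x))
      = lieBracket ℝ (chartVF V x) (chartVF W x) (extChartAt 𝓘(ℝ, E) x x) := by
    rw [ContinuousLinearMap.inverse_id, lieBracketWithin_univ]
    rfl
  rw [← h] at h'
  rw [← mlieBracketWithin_univ, mlieBracketWithin_apply, preimage_univ, univ_inter,
    modelWithCornersSelf_coe, range_id, mpullbackWithin_univ, mpullbackWithin_univ]
  exact h'

end Charts

end Plectic
end

/-! ### Exterior derivative, contraction and Lie bracket on the manifold -/

noncomputable section

namespace Plectic

open ContinuousAlternatingMap VectorField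

lemma minSmoothness_two_le_infty : minSmoothness ℝ 2 ≤ (∞ : WithTop ℕ∞) := by
  rw [minSmoothness_of_isRCLikeNormedField]
  exact WithTop.coe_le_coe.2 (le_top : (2 : ℕ∞) ≤ ⊤)

lemma contDiffOn_curryLeft {E : Type*} [NormedAddCommGroup E] [NormedSpace ℝ E] {k : ℕ}
    {η : E → E [⋀^Fin (k + 1)]→L[ℝ] ℝ} {s : Set E} (hη : ContDiffOn ℝ ∞ η s) :
    ContDiffOn ℝ ∞ (fun y => (η y).curryLeft) s := by
  have h := ContinuousLinearMap.contDiff (𝕜 := ℝ) (E := E [⋀^Fin (k + 1)]→L[ℝ] ℝ)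
    (F := E →L[ℝ] E [⋀^Fin k]→L[ℝ] ℝ) (n := ∞)
    (curryLeftLI (𝕜 := ℝ) (E := E) (F := ℝ) (n := k)).toContinuousLinearMap
  exact ContDiff.comp_contDiffOn (𝕜 := ℝ) (E := E) (F := E [⋀^Fin (k + 1)]→L[ℝ] ℝ)
    (G := E →L[ℝ] E [⋀^Fin k]→L[ℝ] ℝ) (f := η) h hη

section ManifoldCalculus

variable {E : Type*} [NormedAddCommGroup E] [NormedSpace ℝ E]
  {M : Type*} [TopologicalSpace M] [ChartedSpace E M] [IsManifold 𝓘(ℝ, E) ∞ M]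

/-- The exterior derivative may be computed in any chart. -/
lemma chartForm_extDer {k : ℕ} {α : Form E M k} (hα : IsSmoothForm α) {x : M} {y : E}
    (hy : y ∈ (extChartAt 𝓘(ℝ, E) x).target) :
    chartForm (extDer α) x y = extDeriv (chartForm α x) y := by
  set p := (extChartAt 𝓘(ℝ, E) x).symm y
  -- At `p`, `extDer` uses the chart centred at `p`, not the one at `x`. The two expressions of `α`
  -- are related near `y` by pullback along the transition map `φ`, with which `extDeriv` commutes.
  set φ : E → E := extChartAt 𝓘(ℝ, E) p ∘ (extChartAt 𝓘(ℝ, E) x).symm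
  have hcs := (contMDiffOn_extChartAt_symm (I := 𝓘(ℝ, E)) (n := ∞) x).contMDiffAt
    ((isOpen_extChartAt_target x).mem_nhds hy)
  have hφs : ContDiffAt ℝ ∞ φ y :=
    ((contMDiffAt_extChartAt (I := 𝓘(ℝ, E)) (n := ∞) (x := p)).comp y hcs).contDiffAt
  have hs : (extChartAt 𝓘(ℝ, E) x).symm ⁻¹' (extChartAt 𝓘(ℝ, E) p).source ∈ 𝓝 y :=
    hcs.continuousAt.preimage_mem_nhds (extChartAt_source_mem_nhds p)
  have hfd : fderiv ℝ φ y
      = (mfderiv 𝓘(ℝ, E) 𝓘(ℝ, E) (extChartAt 𝓘(ℝ, E) x).symm y : E →L[ℝ] E) := by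
    have h := mfderiv_comp y (mdifferentiableAt_extChartAt (I := 𝓘(ℝ, E)) (mem_chart_source E p))
      (mdifferentiableAt_extChartAt_symm hy)
    have h1 : (mfderiv 𝓘(ℝ, E) 𝓘(ℝ, E) (extChartAt 𝓘(ℝ, E) p) p : E →L[ℝ] E)
      = ContinuousLinearMap.id ℝ E := mfderiv_extChartAt_self
    rw [← mfderiv_eq_fderiv]
    refine h.trans ?_
    change (mfderiv 𝓘(ℝ, E) 𝓘(ℝ, E) (extChartAt 𝓘(ℝ, E) p) p : E →L[ℝ] E) ∘L
      (mfderiv 𝓘(ℝ, E) 𝓘(ℝ, E) (extChartAt 𝓘(ℝ, E) x).symm y : E →L[ℝ] E) = _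
    rw [h1]
    rfl
  have hpull : chartForm α x =ᶠ[𝓝 y]
      fun z => (chartForm α p (φ z)).compContinuousLinearMap (fderiv ℝ φ z) := by
    filter_upwards [eventually_mem_nhds_iff.2 hs,
      (isOpen_extChartAt_target (I := 𝓘(ℝ, E)) x).mem_nhds hy, 
      (hφs.of_le (m := 1) (by simp)).eventually (by simp)]
      with z hz hzt hzφ
    have hzs : (extChartAt 𝓘(ℝ, E) x).symm z ∈ (extChartAt 𝓘(ℝ, E) p).source :=
      mem_preimage.1 (mem_of_mem_nhds hz)
    have hφz : φ z ∈ (extChartAt 𝓘(ℝ, E) p).target := (extChartAt 𝓘(ℝ, E) p).map_source hzs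
    have heq : (extChartAt 𝓘(ℝ, E) p).symm ∘ φ =ᶠ[𝓝 z] (extChartAt 𝓘(ℝ, E) x).symm := by
      filter_upwards [hz] with w hw
      exact (extChartAt 𝓘(ℝ, E) p).left_inv hw
    have h1 := mfderiv_comp z (mdifferentiableAt_extChartAt_symm hφz)
      (hzφ.differentiableAt (by simp)).mdifferentiableAt
    rw [mfderiv_eq_fderiv] at h1
    have h2 : (mfderiv 𝓘(ℝ, E) 𝓘(ℝ, E) ((extChartAt 𝓘(ℝ, E) p).symm ∘ φ) z : E →L[ℝ] E)
      = mfderiv 𝓘(ℝ, E) 𝓘(ℝ, E) (extChartAt 𝓘(ℝ, E) x).symm z := heq.mfderiv_eq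
    have h3 : ∀ q r : M, q = r → ∀ A : E →L[ℝ] E, ((α q).compContinuousLinearMap A :
      E [⋀^Fin k]→L[ℝ] ℝ) = (α r).compContinuousLinearMap A := by
      rintro q _ rfl A; rfl
    have h4 := h3 _ _ heq.eq_of_nhds.symm
      (mfderiv 𝓘(ℝ, E) 𝓘(ℝ, E) (extChartAt 𝓘(ℝ, E) x).symm z)
    refine h4.trans ?_
    rw [← h2]
    exact congrArg (fun A : E →L[ℝ] E =>
      ((α ((extChartAt 𝓘(ℝ, E) p).symm (φ z))).compContinuousLinearMap A :
      E [⋀^Fin k]→L[ℝ] ℝ)) h1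
  rw [hpull.extDeriv_eq, extDeriv_pullback (f := φ) (hα.differentiableAt p) hφs
    minSmoothness_two_le_infty, hfd]
  have h := extDer_apply α p
  exact congrArg (fun T : E [⋀^Fin (k + 1)]→L[ℝ] ℝ => T.compContinuousLinearMap
    (mfderiv 𝓘(ℝ, E) 𝓘(ℝ, E) (extChartAt 𝓘(ℝ, E) x).symm y : E →L[ℝ] E)) h

/-- Chart independence is essential: the inner derivative is needed on a neighbourhood in one fixed
chart before `d² = 0` on `E` applies. -/
lemma extDer_extDer {k : ℕ} {α : Form E M k} (hα : IsSmoothForm α) : extDer (extDer α) = 0 := by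
  funext x
  rw [extDer_apply]
  have h : chartForm (extDer α) x =ᶠ[𝓝 (extChartAt 𝓘(ℝ, E) x x)] extDeriv (chartForm α x) := by
    filter_upwards [extChartAt_target_mem_nhds_self x] with y hy
    exact chartForm_extDer hα hy
  rw [h.extDeriv_eq]
  exact extDeriv_extDeriv_apply ((hα x).contDiffAt (extChartAt_target_mem_nhds_self x))
    minSmoothness_two_le_infty

lemma chartForm_inter_eventuallyEq {k : ℕ} (X : VField E M) (Ω : Form E M (k + 1)) (x : M) :
    chartForm (inter X Ω) x =ᶠ[𝓝 (extChartAt 𝓘(ℝ, E) x x)]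
      fun y => (chartForm Ω x y).curryLeft (chartVF X x y) := by
  filter_upwards [extChartAt_target_mem_nhds_self x] with y hy
  exact chartForm_inter X Ω hy

lemma isSmoothForm_dFun {f : M → ℝ} (hf : ContMDiff 𝓘(ℝ, E) 𝓘(ℝ, ℝ) ∞ f) :
    IsSmoothForm (dFun f : Form E M 1) := by
  intro x
  have h := (contDiffOn_comp_symm hf x).fderiv_of_isOpen (m := ∞) (isOpen_extChartAt_target x)
    (by simp)
  refine ((ContinuousAlternatingMap.ofSubsingletonLIE (𝕜 := ℝ) (E := E) (F := ℝ)
    (0 : Fin 1)).contDiff.comp_contDiffOn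
    h).congr fun y hy => ?_
  rw [chartForm_dFun hf hy]
  rfl

lemma extDer_dFun {f : M → ℝ} (hf : ContMDiff 𝓘(ℝ, E) 𝓘(ℝ, ℝ) ∞ f) :
    extDer (dFun f : Form E M 1) = 0 := by
  funext x
  -- Viewing `f` as a 0-form makes its differential an exterior derivative, so that `d² = 0`
  -- applies.
  have h : chartForm (dFun f) x =ᶠ[𝓝 (extChartAt 𝓘(ℝ, E) x x)]
      extDeriv fun y => constOfIsEmpty ℝ E (Fin 0) ((f ∘ (extChartAt 𝓘(ℝ, E) x).symm) y) := by
    filter_upwards [extChartAt_target_mem_nhds_self x] with y hy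
    rw [extDeriv_constOfIsEmpty, chartForm_dFun hf hy]
  rw [extDer_apply, h.extDeriv_eq]
  refine extDeriv_extDeriv_apply (r := ∞) ?_ minSmoothness_two_le_infty
  have h2 := (contDiffOn_comp_symm hf x).contDiffAt (extChartAt_target_mem_nhds_self x)
  exact (constOfIsEmptyLIE ℝ E ℝ (Fin 0)).contDiff.contDiffAt.comp _ h2

variable [CompleteSpace E]

lemma isSmoothForm_inter {k : ℕ} (X : VField E M) {Ω : Form E M (k + 1)} (hΩ : IsSmoothForm Ω) :
    IsSmoothForm (inter X Ω) := by
  intro x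
  exact ((contDiffOn_curryLeft (hΩ x)).clm_apply (contDiffOn_chartVF X x)).congr fun y hy => chartForm_inter X Ω hy

lemma contMDiff_interOne (X : VField E M) {β : Form E M 1} (hβ : IsSmoothForm β) :
    ContMDiff 𝓘(ℝ, E) 𝓘(ℝ, ℝ) ∞ (interOne X β) := by
  refine contMDiff_of_contDiffOn_comp_symm fun x => ?_
  have h2 := (apply ℝ E ℝ (![] : Fin 0 → E)).contDiff.comp_contDiffOn
    ((contDiffOn_curryLeft (hβ x)).clm_apply (contDiffOn_chartVF X x))
  exact h2.congr fun y hy => interOne_symm X β hy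

/-- The Lie bracket of smooth vector fields. -/
def vfBracket (X Y : VField E M) : VField E M where
  toFun := mlieBracket 𝓘(ℝ, E) X Y
  contMDiff_toFun := by
    have : IsManifold 𝓘(ℝ, E) (minSmoothness ℝ 2) M := .of_le minSmoothness_two_le_infty
    have : IsManifold 𝓘(ℝ, E) ((∞ : WithTop ℕ∞) + 1) M := by simpa
    exact ContDiff.mlieBracket_vectorField (m := ⊤) (n := ⊤) X.contMDiff Y.contMDiff (by simp)

lemma differentiableAt_chartVF (X : VField E M) (x : M) :
    DifferentiableAt ℝ (chartVF X x) (extChartAt 𝓘(ℝ, E) x x) :=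
  ((contDiffOn_chartVF X x).contDiffAt (extChartAt_target_mem_nhds_self x)).differentiableAt
    (by simp)

lemma vfBracket_apply (X Y : VField E M) (x : M) : vfBracket X Y x
    = lieBracket ℝ (chartVF X x) (chartVF Y x) (extChartAt 𝓘(ℝ, E) x x) :=
  mlieBracket_apply_chart _ _ x

omit [CompleteSpace E] in
lemma lieFun_apply (X : VField E M) {f : M → ℝ} (hf : ContMDiff 𝓘(ℝ, E) 𝓘(ℝ, ℝ) ∞ f) (x : M) :
    lieFun X f x = fderiv ℝ (f ∘ (extChartAt 𝓘(ℝ, E) x).symm) (extChartAt 𝓘(ℝ, E) x x)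
      (chartVF X x (extChartAt 𝓘(ℝ, E) x x)) := by
  rw [chartVF_self]
  change dFun f x ![X x] = _
  rw [dFun_apply hf x]
  rfl

omit [CompleteSpace E] in
lemma interOne_comp_symm_eventuallyEq (X : VField E M) (β : Form E M 1) (x : M) :
    interOne X β ∘ (extChartAt 𝓘(ℝ, E) x).symm =ᶠ[𝓝 (extChartAt 𝓘(ℝ, E) x x)]
      fun y => chartForm β x y ![chartVF X x y] := by
  filter_upwards [extChartAt_target_mem_nhds_self x] with y hy
  exact interOne_symm X β hy

/-- Cartan's formula for the exterior derivative of a `1`-form. -/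
lemma lieFun_interOne_sub {β : Form E M 1} (hβ : IsSmoothForm β) (V W : VField E M) (x : M) :
    lieFun V (interOne W β) x - lieFun W (interOne V β) x
      = inter V (extDer β) x ![W x] + interOne (vfBracket V W) β x := by
  rw [lieFun_apply V (contMDiff_interOne W hβ), lieFun_apply W (contMDiff_interOne V hβ),
    (interOne_comp_symm_eventuallyEq W β x).fderiv_eq,
    (interOne_comp_symm_eventuallyEq V β x).fderiv_eq,
    fderiv_apply₁_sub (hβ.differentiableAt x) (differentiableAt_chartVF V x)
      (differentiableAt_chartVF W x), chartVF_self, chartVF_self, ← extDer_apply, chartForm_self,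
    ← vfBracket_apply]
  rfl

section ThreeForm

variable {Ω : Form E M 3} {U V W Z : VField E M}

omit [CompleteSpace E] in
lemma extDeriv_of_inter_closed (h : extDer (inter V Ω) = 0) (x : M) :
    extDeriv (fun y => (chartForm Ω x y).curryLeft (chartVF V x y))
      (extChartAt 𝓘(ℝ, E) x x) = 0 := by
  rw [← (chartForm_inter_eventuallyEq V Ω x).extDeriv_eq, ← extDer_apply, h]
  rfl

lemma extDer_inter_inter (hΩ : IsSmoothForm Ω) (hc : extDer Ω = 0)
    (hV : extDer (inter V Ω) = 0) (hW : extDer (inter W Ω) = 0) :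
    extDer (inter W (inter V Ω)) = - inter (vfBracket V W) Ω := by
  funext x
  have h : chartForm (inter W (inter V Ω)) x =ᶠ[𝓝 (extChartAt 𝓘(ℝ, E) x x)]
      fun y => ((chartForm Ω x y).curryLeft (chartVF V x y)).curryLeft (chartVF W x y) := by
    filter_upwards [extChartAt_target_mem_nhds_self x] with y hy
    rw [chartForm_inter W _ hy, chartForm_inter V _ hy]
  rw [extDer_apply, h.extDeriv_eq, extDeriv_curryLeft_curryLeft (hΩ.differentiableAt x)
    (differentiableAt_chartVF V x) (differentiableAt_chartVF W x)
    (by rw [← extDer_apply, hc]; rfl) (extDeriv_of_inter_closed hV x)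
    (extDeriv_of_inter_closed hW x), ← vfBracket_apply, chartForm_self]
  rfl

/-- The source of the degree `0` Jacobi identity: the right side becomes the Jacobi defect of the
bracket of Hamiltonian forms. -/
lemma dFun_contraction (hΩ : IsSmoothForm Ω) (hc : extDer Ω = 0)
    (hU : extDer (inter U Ω) = 0) (hV : extDer (inter V Ω) = 0) (hW : extDer (inter W Ω) = 0) :
    dFun (interOne W (inter V (inter U Ω))) = - inter U (inter (vfBracket W V) Ω)
      + inter V (inter (vfBracket W U) Ω) + inter W (inter (vfBracket U V) Ω) := by
  funext x
  have h : interOne W (inter V (inter U Ω)) ∘ (extChartAt 𝓘(ℝ, E) x).symm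
      =ᶠ[𝓝 (extChartAt 𝓘(ℝ, E) x x)]
      fun y => chartForm Ω x y ![chartVF U x y, chartVF V x y, chartVF W x y] := by
    filter_upwards [extChartAt_target_mem_nhds_self x] with y hy
    rw [Function.comp_apply, interOne_symm _ _ hy, chartForm_inter V _ hy, chartForm_inter U _ hy]
    rfl
  rw [dFun_apply (contMDiff_interOne W (isSmoothForm_inter V (isSmoothForm_inter U hΩ))),
    h.fderiv_eq]
  refine ext_fin_one fun a => ?_
  have h1 := fderiv_apply₃_of_closed (hΩ.differentiableAt x) (differentiableAt_chartVF U x)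
    (differentiableAt_chartVF V x) (differentiableAt_chartVF W x)
    (by rw [← extDer_apply, hc]; rfl) (extDeriv_of_inter_closed hU x)
    (extDeriv_of_inter_closed hV x) (extDeriv_of_inter_closed hW x) a
  rw [← vfBracket_apply, ← vfBracket_apply, ← vfBracket_apply, chartForm_self, chartVF_self,
    chartVF_self, chartVF_self] at h1
  exact h1

lemma vfBracket_sum (hΩ : IsSmoothForm Ω) (hc : extDer Ω = 0)
    (hU : extDer (inter U Ω) = 0) (hV : extDer (inter V Ω) = 0) (hW : extDer (inter W Ω) = 0)
    (hZ : extDer (inter Z Ω) = 0) (x : M) :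
    Ω x ![vfBracket U V x, W x, Z x] - Ω x ![vfBracket U W x, V x, Z x]
      + Ω x ![vfBracket U Z x, V x, W x] + Ω x ![vfBracket V W x, U x, Z x]
      - Ω x ![vfBracket V Z x, U x, W x] + Ω x ![vfBracket W Z x, U x, V x] = 0 := by
  have h1 := lieBracket_sum_of_closed (hΩ.differentiableAt x) (differentiableAt_chartVF U x)
    (differentiableAt_chartVF V x) (differentiableAt_chartVF W x) (differentiableAt_chartVF Z x)
    (by rw [← extDer_apply, hc]; rfl) (extDeriv_of_inter_closed hU x)
    (extDeriv_of_inter_closed hV x) (extDeriv_of_inter_closed hW x)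
    (extDeriv_of_inter_closed hZ x)
  simp only [← vfBracket_apply, chartForm_self, chartVF_self] at h1
  exact h1

end ThreeForm

end ManifoldCalculus

end Plectic
end

/-! ### The algebra: two weak Lie 2-algebras from one set of contraction data -/

namespace WeakLieTwoAlgebra

section Contraction

variable {K V₁ V₀ W₁ W₀ : Type*} [Field K] [AddCommGroup V₁] [Module K V₁]
  [AddCommGroup V₀] [Module K V₀] [AddCommGroup W₁] [Module K W₁] [AddCommGroup W₀] [Module K W₀]

variable (K V₁ V₀) in
/-- The algebraic structure on a complex `d : V₁ → V₀` from which both `Lie(M, ω)` and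
`Leib(M, ω)` are built: a skew bracket `br` on `V₀` and a pairing `ι x y`, modelled on the bracket
of Hamiltonian forms and the contraction of a form with a Hamiltonian vector field. -/
structure ContractionData where
  /-- the differential -/
  d : V₁ →ₗ[K] V₀
  /-- the skew bracket -/
  br : V₀ →ₗ[K] V₀ →ₗ[K] V₀
  /-- the contraction -/
  ι : V₀ →ₗ[K] V₀ →ₗ[K] V₁
  br_d_left : ∀ f x, br (d f) x = 0
  ι_d_left : ∀ f x, ι (d f) x = 0
  br_skew : ∀ x y, br y x = - br x y
  ι_br_swap : ∀ x y z, ι y (br x z) = - ι x (br y z)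
  d_ι_br_skew : ∀ x y z, d (ι x (br z y)) = - br (br x y) z + br (br x z) y + br (br z y) x
  ι_br_coherence : ∀ x y z w, ι x (br w (br y z)) + ι x (br (br y w) z)
    = ι x (br (br z w) y) + ι (br x y) (br w z) + ι y (br w (br x z)) + ι y (br (br x w) z)
  cartan : ∀ x y z, ι x (d (ι y z)) - ι y (d (ι x z)) = - ι y (br z x) + ι (br x y) z

namespace ContractionData

variable (D : ContractionData K V₁ V₀)

lemma br_d_right (x : V₀) (f : V₁) : D.br x (D.d f) = 0 := by
  rw [D.br_skew, D.br_d_left, neg_zero]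

lemma ι_br_skew (x y z : V₀) : D.ι x (D.br z y) = - D.ι x (D.br y z) := by
  rw [D.br_skew, map_neg]

lemma d_ι_br (x y z : V₀) : D.d (D.ι x (D.br z y))
    = D.br x (D.br y z) - D.br (D.br x y) z - D.br y (D.br x z) := by
  rw [d_ι_br_skew, D.br_skew y (D.br x z), D.br_skew x (D.br z y), D.br_skew y z, map_neg, neg_neg]
  abel

/-- The trilinear map `(x, y, z) ↦ ι x (br z y)`. -/
def jac : V₀ →ₗ[K] V₀ →ₗ[K] V₀ →ₗ[K] V₁ where
  toFun x := D.br.flip.compr₂ (D.ι x)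
  map_add' x y := by ext; simp
  map_smul' c x := by ext; simp

lemma jac_apply (x y z : V₀) : D.jac x y z = D.ι x (D.br z y) := rfl

/-- The semistrict Lie 2-algebra of contraction data. -/
def lie : WeakLieTwoAlgebra K V₁ V₀ where
  d := D.d
  br := D.br
  brL := 0
  brR := 0
  S := 0
  J := D.jac
  d_brL x f := by simp [br_d_right]
  d_brR f x := by simp [br_d_left]
  brL_d := by simp
  d_S x y := by simp [D.br_skew x y]
  S_right := by simp
  S_left := by simp
  d_J x y z := by rw [jac_apply, d_ι_br]; abel
  J_left f y z := by simp [jac_apply, ι_d_left]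
  J_mid x f z := by simp [jac_apply, br_d_right]
  J_right x y f := by simp [jac_apply, br_d_left]
  jacobiator_coherence x y z w := by
    simpa [jac_apply] using D.ι_br_coherence x y z w
  J_swap_left x y z := by
    rw [jac_apply, jac_apply, D.ι_br_skew x, D.ι_br_skew y, D.ι_br_swap x y z]
    simp
  J_swap_right x y z := by
    rw [jac_apply, jac_apply, D.ι_br_skew x]
    simp
  S_br := by simp

/-- The hemistrict weak Lie 2-algebra of contraction data. -/
def leib : WeakLieTwoAlgebra K V₁ V₀ where
  d := D.d
  br := D.br + D.ι.compr₂ D.d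
  brL := D.ι.compl₂ D.d
  brR := 0
  S := D.ι + D.ι.flip
  J := 0
  d_brL x f := by simp [br_d_right]
  d_brR f x := by simp [br_d_left, ι_d_left]
  brL_d f g := by simp [ι_d_left]
  d_S x y := by
    simp only [LinearMap.add_apply, LinearMap.flip_apply, LinearMap.compr₂_apply, map_add,
      D.br_skew x y]
    abel
  S_right x f := by simp [ι_d_left]
  S_left x f := by simp [ι_d_left]
  d_J x y z := by
    simp only [LinearMap.add_apply, LinearMap.compr₂_apply, LinearMap.zero_apply, map_add, map_zero,
      br_d_left, br_d_right, ι_d_left]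
    -- The Jacobi defect of `br` is exact, and the differential of `cartan` supplies exactly the
    -- terms that cancel it.
    have h1 := D.d_ι_br x y z
    have h2 := congrArg D.d (D.cartan x y z)
    have h4 := congrArg D.d (D.ι_br_skew x y z)
    have h5 := congrArg D.d (D.ι_br_skew y x z)
    simp only [map_add, map_sub, map_neg] at h2 h4 h5
    linear_combination (norm := abel) h1 - h2 - h4 + h5
  J_left f y z := by simp
  J_mid x f z := by simp
  J_right x y f := by
    have h := D.cartan x y (D.d f)
    simp only [br_d_left, map_zero, neg_zero, zero_add] at h
    simp only [LinearMap.add_apply, LinearMap.compr₂_apply, LinearMap.compl₂_apply,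
      LinearMap.zero_apply, map_add, ι_d_left, add_zero, ← h]
    abel
  jacobiator_coherence x y z w := by simp
  J_swap_left x y z := by simp
  J_swap_right x y z := by
    -- The symmetrised pairing is invariant: `cartan` is added to itself with `y` and `z` exchanged.
    have h1 := D.cartan x y z
    have h2 := D.cartan x z y
    have h5 := D.ι_br_skew y x z
    have h7 := D.ι_br_skew z x y
    simp only [LinearMap.add_apply, LinearMap.compr₂_apply, LinearMap.compl₂_apply,
      LinearMap.zero_apply, LinearMap.flip_apply, map_add, ι_d_left, add_zero]
    linear_combination (norm := abel) -h1 - h2 + h5 + h7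
  S_br x y z := by
    simp only [LinearMap.add_apply, LinearMap.flip_apply]
    abel

/-- The contraction makes the identity chain map a homomorphism. -/
def lieToLeib : Hom D.lie D.leib where
  φ₀ := LinearMap.id
  φ₁ := LinearMap.id
  Φ := D.ι
  comm_d f := rfl
  d_Φ x y := by simp [lie, leib]
  Φ_right x f := by simp [lie, leib]
  Φ_left f x := by simp [lie, leib, ι_d_left]
  alternator x y := by simp [lie, leib]
  jacobiator x y z := by
    have h1 := D.cartan x y z
    have h4 := D.ι_br_skew x y z
    have h5 := D.ι_br_skew y x z
    simp only [lie, leib, jac_apply, LinearMap.id_apply, LinearMap.zero_apply,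
      LinearMap.compl₂_apply]
    linear_combination (norm := abel) -h1 - h4 + h5

end ContractionData

/-- A homomorphism whose chain map is the identity is an isomorphism. -/
lemma Hom.isIso_of_eq_id {A B : WeakLieTwoAlgebra K V₁ V₀} (F : Hom A B)
    (h₀ : F.φ₀ = LinearMap.id) (h₁ : F.φ₁ = LinearMap.id) : F.IsIso := by
  obtain ⟨φ₀, φ₁, Φ, hd, hdΦ, hΦr, hΦl, hS, hJ⟩ := F
  dsimp only at h₀ h₁
  subst h₀ h₁
  simp only [LinearMap.id_apply] at hd hdΦ hΦr hΦl hS hJ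
  -- The homotopy of a composite over identity chain maps is the sum of the homotopies, so the
  -- inverse must carry `-Φ`.
  refine ⟨⟨LinearMap.id, LinearMap.id, -Φ, fun f => (hd f).symm, fun x y => ?_, fun x f => ?_,
    fun f x => ?_, fun x y => ?_, fun x y z => ?_⟩, ?_, ?_⟩
  · simp [← hd, hdΦ]
  · simp [hd, hΦr]
  · simp [hd, hΦl]
  · have := hS x y
    simp only [LinearMap.neg_apply, LinearMap.id_apply]
    linear_combination (norm := abel) -this
  · have h1 := hJ x y z
    -- The brackets of `A` and `B` differ by `d Φ`; the homotopy identities on these exact terms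
    -- convert the law for one algebra into the law for the other.
    have e1 := hΦr x (Φ y z)
    have e2 := hΦr y (Φ x z)
    have e3 := hΦl (Φ x y) z
    rw [← hd, hdΦ] at e1 e2 e3
    simp only [map_sub, LinearMap.sub_apply] at e1 e2 e3
    simp only [LinearMap.neg_apply, LinearMap.id_apply, map_neg]
    linear_combination (norm := abel) -h1 + e1 - e2 - e3
  · ext <;> simp [Hom.comp, Hom.id]
  · ext <;> simp [Hom.comp, Hom.id]

end Contraction

end WeakLieTwoAlgebra

/-! ### Contraction data of Hamiltonian forms -/

noncomputable section

namespace Plectic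

open ContinuousAlternatingMap VectorField

section Observables

variable {E : Type*} [NormedAddCommGroup E] [NormedSpace ℝ E]
  {M : Type*} [TopologicalSpace M] [ChartedSpace E M] [IsManifold 𝓘(ℝ, E) ∞ M]

omit [IsManifold 𝓘(ℝ, E) ∞ M] in
lemma extDer_neg {k : ℕ} (α : Form E M k) : extDer (-α) = - extDer α := by
  have e : ∀ {j : ℕ} (β : Form E M j), (-1 : ℝ) • β = - β := fun β =>
    funext fun x => neg_one_smul ℝ (M := E [⋀^Fin _]→L[ℝ] ℝ) (β x)
  rw [← e, extDer_smul, e]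

lemma inter_comm (X Y : VField E M) (Ω : Form E M 3) :
    inter X (inter Y Ω) = - inter Y (inter X Ω) := by
  funext x
  refine ext_fin_one (E := E) fun a => ?_
  exact apply_swap₃_left (E := E) (Ω x) (X x) (Y x) a

lemma interOne_add (X : VField E M) (α β : Form E M 1) (x : M) :
    interOne X (α + β) x = interOne X α x + interOne X β x := rfl

lemma interOne_smul (X : VField E M) (c : ℝ) (α : Form E M 1) (x : M) :
    interOne X (c • α) x = c * interOne X α x := rfl

lemma interOne_add_left (X Y : VField E M) (α : Form E M 1) (x : M) :
    interOne (X + Y) α x = interOne X α x + interOne Y α x :=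
  congrArg (fun S => S ![]) (map_add (ContinuousAlternatingMap.curryLeft (E := E) (α x)) (X x) (Y x))

lemma interOne_smul_left (c : ℝ) (X : VField E M) (α : Form E M 1) (x : M) :
    interOne (c • X) α x = c * interOne X α x :=
  congrArg (fun S => S ![]) (map_smul (ContinuousAlternatingMap.curryLeft (E := E) (α x)) c (X x))

lemma interOne_zero_left (α : Form E M 1) (x : M) : interOne (0 : VField E M) α x = 0 := by
  simpa using interOne_smul_left 0 (0 : VField E M) α x

omit [IsManifold 𝓘(ℝ, E) ∞ M] in
lemma dFun_add {f g : M → ℝ} (hf : ContMDiff 𝓘(ℝ, E) 𝓘(ℝ, ℝ) ∞ f)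
    (hg : ContMDiff 𝓘(ℝ, E) 𝓘(ℝ, ℝ) ∞ g) : (dFun (f + g) : Form E M 1) = dFun f + dFun g := by
  funext x
  have h := mfderiv_add (hf.mdifferentiableAt (x := x) (by simp)) (hg.mdifferentiableAt (by simp))
  refine ext_fin_one (E := E) fun a => ?_
  exact congrArg (fun A : E →L[ℝ] ℝ => A a) h

omit [IsManifold 𝓘(ℝ, E) ∞ M] in
lemma dFun_smul (c : ℝ) {f : M → ℝ} (hf : ContMDiff 𝓘(ℝ, E) 𝓘(ℝ, ℝ) ∞ f) :
    (dFun (c • f) : Form E M 1) = c • dFun f := by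
  funext x
  have h := const_smul_mfderiv (hf.mdifferentiableAt (x := x) (by simp)) c
  refine ext_fin_one (E := E) fun a => ?_
  exact congrArg (fun A : E →L[ℝ] ℝ => A a) h

variable {Ω : Form E M 3}

/-- `hamVF` is a choice; nondegeneracy of `Ω` is what makes it linear. -/
lemma hamVF_add (hΩ : IsPlectic 2 Ω) (α β : Ham Ω) :
    hamVF (α + β) = hamVF α + hamVF β := by
  refine (hamVF_unique hΩ _ _ ?_).symm
  rw [Submodule.coe_add, extDer_add α.2.1 β.2.1, hamVF_spec, hamVF_spec, inter_add, neg_add]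

lemma hamVF_smul (hΩ : IsPlectic 2 Ω) (c : ℝ) (α : Ham Ω) : hamVF (c • α) = c • hamVF α := by
  refine (hamVF_unique hΩ _ _ ?_).symm
  rw [Submodule.coe_smul, extDer_smul, hamVF_spec, inter_smul, smul_neg]

/-- The contraction is `-dα`. This is the hypothesis under which every invariance lemma applies. -/
lemma extDer_inter_hamVF (α : Ham Ω) : extDer (inter (hamVF α) Ω) = 0 := by
  rw [← neg_neg (inter (hamVF α) Ω), ← hamVF_spec, extDer_neg, extDer_extDer α.2.1, neg_zero]

/-- The differential `C^∞(M) → Ham(M)`. -/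
def dHam (Ω : Form E M 3) : C^∞⟮𝓘(ℝ, E), M; ℝ⟯ →ₗ[ℝ] Ham Ω where
  toFun f := ⟨dFun f, isSmoothForm_dFun f.contMDiff, 0, by
    rw [extDer_dFun f.contMDiff, inter_zero, neg_zero]⟩
  map_add' f g := Subtype.ext (dFun_add f.contMDiff g.contMDiff)
  map_smul' c f := Subtype.ext (dFun_smul c f.contMDiff)

lemma hamVF_dHam (hΩ : IsPlectic 2 Ω) (f : C^∞⟮𝓘(ℝ, E), M; ℝ⟯) : hamVF (dHam Ω f) = 0 := by
  refine (hamVF_unique hΩ _ _ ?_).symm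
  rw [inter_zero, neg_zero]
  exact extDer_dFun f.contMDiff

variable [CompleteSpace E]

/-- The bracket `{α, β} = Ω(v_α, v_β, ·)` of Hamiltonian forms. -/
def hamBracket (hΩ : IsPlectic 2 Ω) : Ham Ω →ₗ[ℝ] Ham Ω →ₗ[ℝ] Ham Ω :=
  LinearMap.mk₂ ℝ
    (fun α β => ⟨inter (hamVF β) (inter (hamVF α) Ω),
      isSmoothForm_inter _ (isSmoothForm_inter _ hΩ.smooth), vfBracket (hamVF α) (hamVF β),
      extDer_inter_inter hΩ.smooth hΩ.closed (extDer_inter_hamVF α) (extDer_inter_hamVF β)⟩)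
    (fun α α' β => Subtype.ext (by simp only [hamVF_add hΩ, inter_add]; rfl))
    (fun c α β => Subtype.ext (by simp only [hamVF_smul hΩ, inter_smul]; rfl))
    (fun α β β' => Subtype.ext (by simp only [hamVF_add hΩ, inter_add]; rfl))
    (fun c α β => Subtype.ext (by simp only [hamVF_smul hΩ, inter_smul]; rfl))

lemma coe_hamBracket (hΩ : IsPlectic 2 Ω) (α β : Ham Ω) :
    (hamBracket hΩ α β : Form E M 1) = inter (hamVF β) (inter (hamVF α) Ω) := rfl

lemma hamVF_hamBracket (hΩ : IsPlectic 2 Ω) (α β : Ham Ω) :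
    hamVF (hamBracket hΩ α β) = vfBracket (hamVF α) (hamVF β) := by
  refine (hamVF_unique hΩ _ _ ?_).symm
  rw [coe_hamBracket]
  exact extDer_inter_inter hΩ.smooth hΩ.closed (extDer_inter_hamVF α) (extDer_inter_hamVF β)

/-- The pairing `(α, β) ↦ ι_{v_α} β`. -/
def hamContraction (hΩ : IsPlectic 2 Ω) :
    Ham Ω →ₗ[ℝ] Ham Ω →ₗ[ℝ] C^∞⟮𝓘(ℝ, E), M; ℝ⟯ :=
  LinearMap.mk₂ ℝ
    (fun α β => ⟨interOne (hamVF α) β, contMDiff_interOne _ β.2.1⟩)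
    (fun α α' β => ContMDiffMap.ext fun x => by
      rw [hamVF_add hΩ]; exact interOne_add_left _ _ _ x)
    (fun c α β => ContMDiffMap.ext fun x => by
      rw [hamVF_smul hΩ]; exact interOne_smul_left _ _ _ x)
    (fun α β β' => ContMDiffMap.ext fun x => interOne_add _ _ _ x)
    (fun c α β => ContMDiffMap.ext fun x => interOne_smul _ _ _ x)

lemma hamContraction_apply (hΩ : IsPlectic 2 Ω) (α β : Ham Ω) (x : M) :
    hamContraction hΩ α β x = interOne (hamVF α) (β : Form E M 1) x := rfl

/-- This identifies the abstract `jac` with the Jacobiator `Ω(v_γ, v_β, v_α)`. -/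
lemma hamContraction_hamBracket (hΩ : IsPlectic 2 Ω) (α β γ : Ham Ω) (x : M) :
    hamContraction hΩ α (hamBracket hΩ β γ) x = Ω x ![hamVF β x, hamVF γ x, hamVF α x] := rfl

/-- The contraction data of a 2-plectic manifold. -/
def contractionData (hΩ : IsPlectic 2 Ω) :
    WeakLieTwoAlgebra.ContractionData ℝ C^∞⟮𝓘(ℝ, E), M; ℝ⟯ (Ham Ω) where
  d := dHam Ω
  br := hamBracket hΩ
  ι := hamContraction hΩ
  br_d_left f x := Subtype.ext (by
    rw [coe_hamBracket, hamVF_dHam hΩ, inter_zero]; rfl)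
  ι_d_left f α := ContMDiffMap.ext fun x => by
    rw [hamContraction_apply, hamVF_dHam hΩ]; exact interOne_zero_left _ x
  br_skew α β := Subtype.ext (inter_comm _ _ _)
  ι_br_swap α β γ := ContMDiffMap.ext fun x => by
    have h1 := apply_swap₃_right (E := E) (Ω x) (hamVF α x) (hamVF β x) (hamVF γ x)
    have h2 := apply_swap₃_right (E := E) (Ω x) (hamVF β x) (hamVF α x) (hamVF γ x)
    have h3 := apply_swap₃_left (E := E) (Ω x) (hamVF α x) (hamVF β x) (hamVF γ x)
    rw [ContMDiffMap.coe_neg, Pi.neg_apply, hamContraction_hamBracket, hamContraction_hamBracket]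
    exact h1.trans (congrArg Neg.neg (h2.trans ((congrArg Neg.neg h3).trans (neg_neg _)))).symm
  d_ι_br_skew α β γ := by
    have h := dFun_contraction (U := hamVF γ) (V := hamVF β) (W := hamVF α) hΩ.smooth hΩ.closed
      (extDer_inter_hamVF _) (extDer_inter_hamVF _) (extDer_inter_hamVF _)
    simp only [← hamVF_hamBracket hΩ] at h
    exact Subtype.ext h
  ι_br_coherence α β γ δ := ContMDiffMap.ext fun x => by
    have h := vfBracket_sum (U := hamVF α) (V := hamVF β) (W := hamVF γ) (Z := hamVF δ)
      hΩ.smooth hΩ.closed (extDer_inter_hamVF _) (extDer_inter_hamVF _) (extDer_inter_hamVF _)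
      (extDer_inter_hamVF _) x
    simp only [← hamVF_hamBracket hΩ] at h
    have sw : ∀ (p q r : Ham Ω), (Ω x ![hamVF p x, hamVF r x, hamVF q x] : ℝ)
        = - Ω x ![hamVF p x, hamVF q x, hamVF r x] :=
      fun p q r => apply_swap₃_right (E := E) (Ω x) _ _ _
    have sw' : ∀ (p q r : Ham Ω), (Ω x ![hamVF q x, hamVF p x, hamVF r x] : ℝ)
        = - Ω x ![hamVF p x, hamVF q x, hamVF r x] :=
      fun p q r => apply_swap₃_left (E := E) (Ω x) _ _ _
    simp only [ContMDiffMap.coe_add, Pi.add_apply, hamContraction_hamBracket]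
    -- Transpositions of arguments match the terms of the coherence law with those of
    -- `vfBracket_sum`.
    have e1 := sw' (hamBracket hΩ β γ) δ α
    have e2 := sw (hamBracket hΩ β γ) α δ
    have e3 := sw (hamBracket hΩ β δ) α γ
    have e4 := sw (hamBracket hΩ γ δ) α β
    have e5 := sw δ (hamBracket hΩ α β) γ
    have e6 := sw' (hamBracket hΩ α β) δ γ
    have e7 := sw (hamBracket hΩ α β) γ δ
    have e8 := sw' (hamBracket hΩ α γ) δ β
    have e9 := sw (hamBracket hΩ α γ) β δ
    have e10 := sw (hamBracket hΩ α δ) β γ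
    linear_combination h + e1 - e2 + e3 - e4 - e5 + e6 - e7 - e8 + e9 - e10
  cartan α β γ := ContMDiffMap.ext fun x => by
    have h := lieFun_interOne_sub γ.2.1 (hamVF α) (hamVF β) x
    -- With `dγ = -ι_{v_γ} Ω`, the curvature-like term `dγ(v_α, v_β)` of Cartan's formula becomes
    -- `-ι_{v_β} {γ, α}`.
    rw [hamVF_spec, ← hamVF_hamBracket hΩ] at h
    exact h

omit [CompleteSpace E] in
/-- `Lie(M, Ω)` is determined by its structure maps. -/
lemma IsLie.eq {A A' : WeakLieTwoAlgebra ℝ C^∞⟮𝓘(ℝ, E), M; ℝ⟯ (Ham Ω)} (h : IsLie A)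
    (h' : IsLie A') : A = A' := by
  apply WeakLieTwoAlgebra.ext
  · exact LinearMap.ext fun f => Subtype.ext ((h.d_eq f).trans (h'.d_eq f).symm)
  · exact LinearMap.ext₂ fun α β => Subtype.ext ((h.br_eq α β).trans (h'.br_eq α β).symm)
  · exact LinearMap.ext₂ fun α f => (h.brL_eq α f).trans (h'.brL_eq α f).symm
  · exact LinearMap.ext₂ fun f α => (h.brR_eq f α).trans (h'.brR_eq f α).symm
  · exact LinearMap.ext₂ fun α β => (h.S_eq α β).trans (h'.S_eq α β).symm
  · exact LinearMap.ext₂ fun α β => LinearMap.ext fun γ => ContMDiffMap.ext fun x =>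
      (h.J_eq α β γ x).trans (h'.J_eq α β γ x).symm

omit [CompleteSpace E] in
/-- `Leib(M, Ω)` is determined by its structure maps. -/
lemma IsLeib.eq {B B' : WeakLieTwoAlgebra ℝ C^∞⟮𝓘(ℝ, E), M; ℝ⟯ (Ham Ω)} (h : IsLeib B)
    (h' : IsLeib B') : B = B' := by
  apply WeakLieTwoAlgebra.ext
  · exact LinearMap.ext fun f => Subtype.ext ((h.d_eq f).trans (h'.d_eq f).symm)
  · exact LinearMap.ext₂ fun α β => Subtype.ext ((h.br_eq α β).trans (h'.br_eq α β).symm)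
  · exact LinearMap.ext₂ fun α f => ContMDiffMap.ext fun x =>
      (h.brL_eq α f x).trans (h'.brL_eq α f x).symm
  · exact LinearMap.ext₂ fun f α => (h.brR_eq f α).trans (h'.brR_eq f α).symm
  · exact LinearMap.ext₂ fun α β => ContMDiffMap.ext fun x =>
      (h.S_eq α β x).trans (h'.S_eq α β x).symm
  · exact LinearMap.ext₂ fun α β => LinearMap.ext fun γ =>
      (h.J_eq α β γ).trans (h'.J_eq α β γ).symm

lemma isLie_lie (hΩ : IsPlectic 2 Ω) : IsLie (contractionData hΩ).lie where
  d_eq _ := rfl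
  br_eq _ _ := rfl
  brL_eq _ _ := rfl
  brR_eq _ _ := rfl
  S_eq _ _ := rfl
  J_eq α β γ x := hamContraction_hamBracket hΩ α γ β x

/-- The term `ι_{v_α} dβ = -ι_{v_α} ι_{v_β} Ω` is `{α, β}` by skewness, so the Leibniz bracket is
the Lie bracket plus `d` of the pairing; in particular it is again Hamiltonian. -/
lemma lieOne_hamVF (hΩ : IsPlectic 2 Ω) (α β : Ham Ω) : lieOne (hamVF α) (β : Form E M 1)
    = (hamBracket hΩ α β + dHam Ω (hamContraction hΩ α β) : Ham Ω) := by
  have h : inter (hamVF α) (- inter (hamVF β) Ω) = inter (hamVF β) (inter (hamVF α) Ω) := by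
    rw [inter_comm (hamVF β)]
    rfl
  rw [lieOne, hamVF_spec, h, add_comm]
  rfl

lemma isLeib_leib (hΩ : IsPlectic 2 Ω) : IsLeib (contractionData hΩ).leib where
  d_eq _ := rfl
  br_eq α β := (lieOne_hamVF hΩ α β).symm
  brL_eq _ _ _ := rfl
  brR_eq _ _ := rfl
  S_eq _ _ _ := rfl
  J_eq _ _ _ := rfl

end Observables

end Plectic
end

theorem mainTheorem10 {E : Type*} [NormedAddCommGroup E] [NormedSpace ℝ E] [FiniteDimensional ℝ E]
    {M : Type*} [TopologicalSpace M] [ChartedSpace E M] [IsManifold 𝓘(ℝ, E) ∞ M]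
    (Ω : Plectic.Form E M 3) (hΩ : Plectic.IsPlectic 2 Ω) :
    (∃! A : WeakLieTwoAlgebra ℝ C^∞⟮𝓘(ℝ, E), M; ℝ⟯ (Plectic.Ham Ω), Plectic.IsLie A) ∧
    (∃! B : WeakLieTwoAlgebra ℝ C^∞⟮𝓘(ℝ, E), M; ℝ⟯ (Plectic.Ham Ω), Plectic.IsLeib B) ∧
    ∀ A B : WeakLieTwoAlgebra ℝ C^∞⟮𝓘(ℝ, E), M; ℝ⟯ (Plectic.Ham Ω),
      Plectic.IsLie A → Plectic.IsLeib B →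
        A.IsSemistrict ∧ B.IsHemistrict ∧
        ∃ F : WeakLieTwoAlgebra.Hom A B,
          F.φ₀ = LinearMap.id ∧ F.φ₁ = LinearMap.id ∧
          (∀ (α β : Plectic.Ham Ω) (x : M),
            F.Φ α β x = Plectic.interOne (Plectic.hamVF α) (β : Plectic.Form E M 1) x) ∧
          F.IsIso := by
  -- Finite dimension enters only through completeness, used for the smoothness of pulled-back
  -- vector fields and of Lie brackets.
  have : CompleteSpace E := FiniteDimensional.complete ℝ E
  have hA := Plectic.isLie_lie hΩ
  have hB := Plectic.isLeib_leib hΩ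
  refine ⟨⟨_, hA, fun A h => h.eq hA⟩, ⟨_, hB, fun B h => h.eq hB⟩, fun A B h h' => ?_⟩
  -- By uniqueness `A` and `B` are the constructed algebras, whose structure maps are known
  -- definitionally.
  obtain rfl := h.eq hA
  obtain rfl := h'.eq hB
  exact ⟨rfl, rfl, (Plectic.contractionData hΩ).lieToLeib, rfl, rfl, fun _ _ _ => rfl,
    WeakLieTwoAlgebra.Hom.isIso_of_eq_id _ rfl rfl⟩
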